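/- Let $0<q<1$ and let $\kappa,\lambda,\upsilon,\varsigma\in\mathbb{R}$ and $s>0$ be real. For $x\in\mathbb{C}$ put $q^x=e^{x\log q}$ and $(u_1,\dots,u_m;p)_\infty=\prod_{i=1}^m\prod_{j\ge 0}(1-u_ip^j)$. Put $$(a,b,c,d)=\bigl(q^{\kappa+\lambda},-q^{\kappa-\lambda},q^{s/2+\upsilon+\varsigma},-q^{s/2+\upsilon-\varsigma}\bigr),\qquad \widetilde a=q^{\kappa+\upsilon},$$ and let $\mathcal{D}$ be the Askey--Wilson second order difference operator with step-size $s$, $$(\mathcal{D}f)(x)=A(x)\bigl(f(x+s)-f(x)\bigr)+A(-x)\bigl(f(x-s)-f(x)\bigr),\qquad A(x)=\frac{(1-aq^x)(1-bq^x)(1-cq^x)(1-dq^x)}{\widetilde a\,(1-q^{2x})(1-q^{s+2x})}.$$ Let $W(x,z)=q^{(\kappa+\lambda+x)(\kappa+\upsilon+z)/s}$ and $\mathrm{St}(x)=\bigl(q^{s+x}/a,q^{s+x}/b,q^{s+x}/c,q^{s+x}/d;q^s\bigr)_\infty$, and let $\mathrm{St}^d$ be $\mathrm{St}$ with $\lambda$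 and $\upsilon$ interchanged. The asymptotically free eigenfunction $$\Phi(x,z)=\Phi(x,z;\kappa,\lambda,\upsilon,\varsigma;q,s)=\frac{W(x,z)}{\mathrm{St}(x)\,\mathrm{St}^d(z)}\sum_{r=0}^\infty\Gamma_r(z)q^{rx}$$ is the meromorphic function on $\mathbb{C}\times\mathbb{C}$ defined by the unique sequence of entire functions $\Gamma_r$ ($r\ge 0$) such that 1. $\Gamma_0(z)=(q^{s+2z};q^s)_\infty$; 2. $\sum_{r\ge 0}\Gamma_r(z)q^{rx}$ converges normally on compacta of $\mathbb{C}\times\mathbb{C}$; 3. $\bigl(\mathcal{D}_x-q^z-q^{-z}+\widetilde a+\widetilde a^{-1}\bigr)\Phi(x,z)=0$ as an identity of meromorphic functions, where $\mathcal{D}_x$ is $\mathcal{D}$ acting on the variable $x$. **Theorem.** Let $\kappa,\lambda\in\mathbb{R}$, $s>0$ and $0<q<1$. For each of the parameters $(\kappa,\lambda,\kappa,\lambda;q,s)$ and $(\kappa,\lambda,0,0;q,s/2)$, the sequence $(\Gamma_r)_{r\ge 0}$ characterized above exists and is unique, and $$\Phi(x,z;\kappa,\lambda,\kappa,\lambda;q,s)=\Phi\Bigl(x,\frac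 z2;\kappa,\lambda,0,0;q,\frac s2\Bigr)$$ as meromorphic functions of $(x,z)\in\mathbb{C}\times\mathbb{C}$, that is, at all points where the denominators $\mathrm{St}(x)\,\mathrm{St}^d(z)$ of the left hand side and $\mathrm{St}(x)\,\mathrm{St}^d(z/2)$ of the right hand side (each formed with its own parameters) do not vanish. -/

import Mathlib

namespace AskeyWilson

/-- Real Hecke parameters `(κ, lam, υ, ς)`, a step-size `s` and a deformation parameter `q`. -/
structure Params where
  κ : ℝ
  lam : ℝ
  υ : ℝ
  ς : ℝ
  s : ℝ
  q : ℝ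

/-- The infinite `p`-shifted factorial `(u; p)_∞ = ∏_{j ≥ 0} (1 - u p ^ j)` (used for `|p| < 1`). -/
noncomputable def qPochInf (u p : ℂ) : ℂ :=
  ∏' j : ℕ, (1 - u * p ^ j)

namespace Params

/-- The dual parameters: the roles of `lam` and `υ` are interchanged. -/
def dual (P : Params) : Params :=
  { P with lam := P.υ, υ := P.lam }

/-- `P.pow x` is `q ^ x` for complex `x`; for `q > 0` it equals `exp (x log q)`. -/
noncomputable def pow (P : Params) (x : ℂ) : ℂ :=
  (P.q : ℂ) ^ x

/-- The Askey-Wilson parameter `a = q ^ (κ + lam)`. -/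
noncomputable def a (P : Params) : ℂ :=
  P.pow (P.κ + P.lam)

/-- The Askey-Wilson parameter `b = - q ^ (κ - lam)`. -/
noncomputable def b (P : Params) : ℂ :=
  -P.pow (P.κ - P.lam)

/-- The Askey-Wilson parameter `c = q ^ (s / 2 + υ + ς)`. -/
noncomputable def c (P : Params) : ℂ :=
  P.pow (P.s / 2 + P.υ + P.ς)

/-- The Askey-Wilson parameter `d = - q ^ (s / 2 + υ - ς)`. -/
noncomputable def d (P : Params) : ℂ :=
  -P.pow (P.s / 2 + P.υ - P.ς)

/-- The coefficient `A(x)` of the Askey-Wilson operator; `P.dual.a = q ^ (κ + υ)` is the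
dual parameter usually written `a` with a tilde. -/
noncomputable def A (P : Params) (x : ℂ) : ℂ :=
  ((1 - P.a * P.pow x) * (1 - P.b * P.pow x) * (1 - P.c * P.pow x) * (1 - P.d * P.pow x)) /
    (P.dual.a * (1 - P.pow (2 * x)) * (1 - P.pow (P.s + 2 * x)))

/-- The Askey-Wilson second order difference operator with step-size `s`. -/
noncomputable def D (P : Params) (f : ℂ → ℂ) (x : ℂ) : ℂ :=
  P.A x * (f (x + P.s) - f x) + P.A (-x) * (f (x - P.s) - f x)

/-- `W(x, z) = q ^ ((κ + lam + x) (κ + υ + z) / s)`. -/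
noncomputable def W (P : Params) (x z : ℂ) : ℂ :=
  P.pow ((P.κ + P.lam + x) * (P.κ + P.υ + z) / P.s)

/-- The singular term
`St(x) = (q^(s+x)/a, q^(s+x)/b, q^(s+x)/c, q^(s+x)/d; q^s)_∞`. -/
noncomputable def St (P : Params) (x : ℂ) : ℂ :=
  qPochInf (P.pow (P.s + x) / P.a) (P.pow P.s) *
    qPochInf (P.pow (P.s + x) / P.b) (P.pow P.s) *
    qPochInf (P.pow (P.s + x) / P.c) (P.pow P.s) *
    qPochInf (P.pow (P.s + x) / P.d) (P.pow P.s)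

/-- The sum `∑_{r ≥ 0} Γ_r(z) q^(r x)` attached to coefficient functions `Γ_r`. -/
noncomputable def series (P : Params) (Γ : ℕ → ℂ → ℂ) (x z : ℂ) : ℂ :=
  ∑' r : ℕ, Γ r z * P.pow (r * x)

/-- The meromorphic function `W(x, z) / (St(x) St^d(z)) * ∑_{r ≥ 0} Γ_r(z) q^(r x)`. Its values
are meaningful where `St(x)` and the dual singular term `St^d(z)` do not vanish. -/
noncomputable def ansatz (P : Params) (Γ : ℕ → ℂ → ℂ) (x z : ℂ) : ℂ :=
  P.W x z / (P.St x * P.dual.St z) * P.series Γ x z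

/-- The characterizing conditions on the coefficient functions `Γ_r` of the asymptotically free
eigenfunction. -/
structure IsAsymptoticallyFree (P : Params) (Γ : ℕ → ℂ → ℂ) : Prop where
  /-- Every `Γ_r` is entire. -/
  holomorphic : ∀ r, Differentiable ℂ (Γ r)
  /-- The normalization `Γ_0(z) = (q^(s+2z); q^s)_∞`. -/
  leading : ∀ z, Γ 0 z = qPochInf (P.pow (P.s + 2 * z)) (P.pow P.s)
  /-- Normal convergence of `∑_r Γ_r(z) q^(r x)` on compacta of `ℂ × ℂ`. -/
  normal : ∀ K : Set (ℂ × ℂ), IsCompact K →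
    ∃ M : ℕ → ℝ, Summable M ∧ ∀ r, ∀ p ∈ K, ‖Γ r p.2 * P.pow (r * p.1)‖ ≤ M r
  /-- The Askey-Wilson difference equation in `x`. It is an identity of meromorphic functions,
  stated at all points where no denominator occurring in it vanishes. -/
  equation : ∀ x z : ℂ,
    P.pow (2 * x) ≠ 1 → P.pow (P.s + 2 * x) ≠ 1 → P.pow (P.s - 2 * x) ≠ 1 →
    P.St x ≠ 0 → P.St (x + P.s) ≠ 0 → P.St (x - P.s) ≠ 0 → P.dual.St z ≠ 0 →
      P.D (fun y => P.ansatz Γ y z) x +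
        (-P.pow z - P.pow (-z) + P.dual.a + P.dual.a⁻¹) * P.ansatz Γ x z = 0

/-- The coefficient functions of the asymptotically free eigenfunction: the functions
characterized by `IsAsymptoticallyFree`. -/
noncomputable def Gam (P : Params) : ℕ → ℂ → ℂ :=
  Classical.epsilon P.IsAsymptoticallyFree

/-- The asymptotically free eigenfunction `Φ(x, z)`. -/
noncomputable def Phi (P : Params) (x z : ℂ) : ℂ :=
  P.ansatz P.Gam x z

end Params

/-- The specialization `(κ, lam, κ, lam; q, s)`. -/
def paramsJ (κ lam s q : ℝ) : Params :=
  ⟨κ, lam, κ, lam, s, q⟩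

/-- The specialization `(κ, lam, 0, 0; q, s / 2)`. -/
noncomputable def paramsR (κ lam s q : ℝ) : Params :=
  ⟨κ, lam, 0, 0, s / 2, q⟩

end AskeyWilson

/-! Write `h = q^(s/2)`, `X = q^x`, `t = q^z`, and let `a`, `b` be the first two Askey--Wilson
parameters, which both specializations share. Both eigenfunctions come from one entire function
`H(t, Y)` solving the three-term relation `t P(Y) H(hY) + H(Y/h) = (1 + t)(1 - Y^2) H(Y)`, where
`P(Y) = (1 - aY)(1 - bY)(1 - hY/a)(1 - hY/b)`.

For step-size `s/2` the parameters `c` and `d` are `±q^(s/4)`. Their contribution to the operator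
cancels against a denominator, and their contribution to `St` is `(hX^2; h^2)_∞`. Removing this
factor from the series turns the difference equation into the relation for `H(q^(2z), ·)`. For
step-size `s` one has `c = ha`, `d = hb`, and the relations at `X`, `hX` and `X/h` combine to the
difference equation with steps `h^2`, solved by `H(q^z, ·)`. After `z ↦ z/2` in the first case the
two values of `t` agree, the factors `W` agree, and the remaining quotients of infinite products
cancel.

The relation is solved by a power series in `Y` (`entireSolution_equation`). Its recursion carries a
factor `h^n`, so the series converges everywhere, and the leading coefficient `(ht; h)_∞` absorbs
the poles in `t`. The two specializations follow from `paramsR_normalizedEquation` and from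
`second_order_of_first_order`, used in `paramsJ_normalizedEquation`. Uniqueness
(`IsAsymptoticallyFree.unique`) comes from the indicial equation as `x → +∞` together with the
identity theorem in `z`; it identifies the functions chosen in `Gam` with the explicit ones. -/

namespace AskeyWilson

open Filter Topology

/-! ### Infinite shifted factorials -/

section QPochhammer

variable {p : ℂ}

theorem summable_norm_qPochInf_factor (hp : ‖p‖ < 1) (u : ℂ) :
    Summable fun j : ℕ => ‖-(u * p ^ j)‖ := by
  simpa using (summable_geometric_of_lt_one (norm_nonneg p) hp).mul_left ‖u‖

theorem multipliable_qPochInf (hp : ‖p‖ < 1) (u : ℂ) :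
    Multipliable fun j : ℕ => 1 - u * p ^ j := by
  simpa [sub_eq_add_neg] using
    multipliable_one_add_of_summable (summable_norm_qPochInf_factor hp u)

theorem qPochInf_step (hp : ‖p‖ < 1) (u : ℂ) :
    qPochInf u p = (1 - u) * qPochInf (u * p) p := by
  have h := multipliable_qPochInf hp (u * p)
  have e : (fun j : ℕ => 1 - u * p * p ^ j) = fun j => 1 - u * p ^ (j + 1) := by
    funext j; ring
  rw [e] at h
  have h0 := tprod_eq_zero_mul' (f := fun j : ℕ => 1 - u * p ^ j) h
  rw [qPochInf, qPochInf, h0, e, pow_zero, mul_one]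

theorem qPochInf_zero (p : ℂ) : qPochInf 0 p = 1 := by
  simp [qPochInf]

theorem differentiable_qPochInf (hp : ‖p‖ < 1) :
    Differentiable ℂ fun u => qPochInf u p := by
  have key : ∀ R : ℝ, DifferentiableOn ℂ (fun u => qPochInf u p) (Metric.ball 0 R) := by
    intro R
    have hs : Summable fun j : ℕ => R * ‖p‖ ^ j :=
      (summable_geometric_of_lt_one (norm_nonneg p) hp).mul_left R
    have hl := hs.hasProdLocallyUniformlyOn_nat_one_add
      (f := fun j (u : ℂ) => -(u * p ^ j)) (K := Metric.ball 0 R) Metric.isOpen_ball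
      (.of_forall fun j u hu => by
        rw [norm_neg, norm_mul, norm_pow]
        have : ‖u‖ ≤ R := by simpa using (Metric.mem_ball.1 hu).le
        gcongr) (fun j => by fun_prop)
    have hd := hl.differentiableOn
      (.of_forall fun _ => by
        simpa [Finset.prod_fn] using DifferentiableOn.finsetProd (fun _ _ => by fun_prop))
      Metric.isOpen_ball
    simpa [qPochInf, sub_eq_add_neg] using hd
  intro u
  exact (key (‖u‖ + 1)).differentiableAt (Metric.isOpen_ball.mem_nhds (by simp))

theorem continuous_qPochInf (hp : ‖p‖ < 1) : Continuous fun u => qPochInf u p :=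
  (differentiable_qPochInf hp).continuous

theorem norm_sq_lt_one (hp : ‖p‖ < 1) : ‖p ^ 2‖ < 1 := by
  rw [norm_pow]; exact pow_lt_one₀ (norm_nonneg _) hp two_ne_zero

/-- Splitting a product of base `p` into its factors of even and of odd index. -/
theorem qPochInf_even_mul_odd (hp : ‖p‖ < 1) (u : ℂ) :
    qPochInf u (p ^ 2) * qPochInf (u * p) (p ^ 2) = qPochInf u p := by
  have h2 := norm_sq_lt_one hp
  have he := multipliable_qPochInf h2 u
  have ho := multipliable_qPochInf h2 (u * p)
  have ee : (fun j : ℕ => 1 - u * (p ^ 2) ^ j) = fun j => 1 - u * p ^ (2 * j) := by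
    funext j; rw [pow_mul]
  have eo : (fun j : ℕ => 1 - u * p * (p ^ 2) ^ j) = fun j => 1 - u * p ^ (2 * j + 1) := by
    funext j; rw [pow_succ p (2 * j), pow_mul]; ring
  rw [ee] at he
  rw [eo] at ho
  rw [qPochInf, qPochInf, qPochInf, ee, eo]
  exact tprod_even_mul_odd (f := fun k => 1 - u * p ^ k) he ho

theorem qPochInf_mul_neg (hp : ‖p‖ < 1) (u : ℂ) :
    qPochInf u p * qPochInf (-u) p = qPochInf (u ^ 2) (p ^ 2) := by
  rw [qPochInf, qPochInf, qPochInf,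
    ← (multipliable_qPochInf hp u).tprod_mul (multipliable_qPochInf hp (-u))]
  congr 1
  funext j
  rw [← pow_mul, mul_comm 2 j, pow_mul]
  ring

end QPochhammer

/-! ### Growth of sequences with a superexponentially small recursion -/

section Majorant

/-- The factor `h ^ n` eventually beats every constant, so the weighted sequence `u n * ρ ^ n` stays
bounded for each `ρ`; taking `ρ` larger than `|R|` leaves a geometric series. -/
theorem summable_of_superexponential_recurrence {u : ℕ → ℝ} {K h : ℝ} (hu : ∀ n, 0 ≤ u n)
    (h0 : 0 ≤ h) (h1 : h < 1) (hK : 0 ≤ K)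
    (hrec : ∀ n, u (n + 4) ≤ K * h ^ n * (u n + u (n + 1) + u (n + 2) + u (n + 3))) (R : ℝ) :
    Summable fun n => u n * R ^ n := by
  -- The factor 2 yields the final ratio `1 / 2`; the summand 1 gives `1 ≤ ρ`, so that lower powers
  -- of `ρ` can be replaced by higher ones.
  set ρ : ℝ := 2 * (|R| + 1) with hρ
  have hρ1 : 1 ≤ ρ := by rw [hρ]; linarith [abs_nonneg R]
  set v : ℕ → ℝ := fun n => u n * ρ ^ n with hv
  have hv0 : ∀ n, 0 ≤ v n := fun n => by simp only [hv]; have := hu n; positivity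
  have hvrec : ∀ n, v (n + 4) ≤ K * ρ ^ 4 * h ^ n * (v n + v (n + 1) + v (n + 2) + v (n + 3)) := by
    intro n
    have le : ∀ i, u (n + i) * ρ ^ n ≤ v (n + i) := fun i => by
      simp only [hv]
      exact mul_le_mul_of_nonneg_left (pow_le_pow_right₀ hρ1 (by omega)) (hu _)
    calc v (n + 4) = u (n + 4) * (ρ ^ 4 * ρ ^ n) := by simp only [hv]; ring
      _ ≤ (K * h ^ n * (u n + u (n + 1) + u (n + 2) + u (n + 3))) * (ρ ^ 4 * ρ ^ n) :=
        mul_le_mul_of_nonneg_right (hrec n) (by positivity)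
      _ = K * ρ ^ 4 * h ^ n * (u (n + 0) * ρ ^ n + u (n + 1) * ρ ^ n + u (n + 2) * ρ ^ n
            + u (n + 3) * ρ ^ n) := by rw [add_zero]; ring
      _ ≤ _ := by
        have := le 0; have := le 1; have := le 2; have := le 3
        refine mul_le_mul_of_nonneg_left ?_ (by positivity)
        simp only [add_zero] at *
        linarith
  -- From `N` on, a new term is at most the largest of the four preceding ones, so the sum `B` of
  -- the initial terms bounds the whole sequence.
  obtain ⟨N, hN⟩ : ∃ N, ∀ n, N ≤ n → K * ρ ^ 4 * h ^ n * 4 ≤ 1 := by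
    have : Tendsto (fun n : ℕ => K * ρ ^ 4 * h ^ n * 4) atTop (𝓝 (K * ρ ^ 4 * 0 * 4)) :=
      ((tendsto_pow_atTop_nhds_zero_of_lt_one h0 h1).const_mul _).mul_const _
    rw [mul_zero, zero_mul] at this
    exact eventually_atTop.1 (this.eventually (ge_mem_nhds one_pos))
  set B := ∑ i ∈ Finset.range (N + 4), v i with hB
  have hB0 : 0 ≤ B := Finset.sum_nonneg fun i _ => hv0 i
  have hbound : ∀ m, v m ≤ B := by
    intro m
    induction m using Nat.strong_induction_on with
    | _ m ih =>
      by_cases hm : m < N + 4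
      · exact Finset.single_le_sum (f := v) (fun i _ => hv0 i) (Finset.mem_range.2 hm)
      · obtain ⟨n, rfl⟩ : ∃ n, m = n + 4 := ⟨m - 4, by omega⟩
        have a0 := ih n (by omega)
        have a1 := ih (n + 1) (by omega)
        have a2 := ih (n + 2) (by omega)
        have a3 := ih (n + 3) (by omega)
        calc v (n + 4) ≤ _ := hvrec n
          _ ≤ K * ρ ^ 4 * h ^ n * (4 * B) :=
            mul_le_mul_of_nonneg_left (by linarith) (by positivity)
          _ = K * ρ ^ 4 * h ^ n * 4 * B := by ring
          _ ≤ 1 * B := mul_le_mul_of_nonneg_right (hN n (by omega)) hB0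
          _ = B := one_mul B
  refine Summable.of_norm_bounded
    ((summable_geometric_of_lt_one (r := 1 / 2) (by norm_num) (by norm_num)).mul_left B) fun n => ?_
  rw [Real.norm_eq_abs, abs_mul, abs_of_nonneg (hu n), abs_pow]
  calc u n * |R| ^ n ≤ u n * (ρ * (1 / 2)) ^ n := by
        have := hu n
        have : |R| ≤ ρ * (1 / 2) := by rw [hρ]; linarith
        gcongr
    _ = v n * (1 / 2) ^ n := by simp only [hv]; rw [mul_pow]; ring
    _ ≤ B * (1 / 2) ^ n := mul_le_mul_of_nonneg_right (hbound n) (by positivity)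

/-- The sequence which satisfies `summable_of_superexponential_recurrence` with equality. -/
def majorant (K h : ℝ) : ℕ → ℝ
  | 0 => 0
  | 1 => 0
  | 2 => 0
  | 3 => 1
  | n + 4 => K * h ^ n *
      (majorant K h n + majorant K h (n + 1) + majorant K h (n + 2) + majorant K h (n + 3))

theorem majorant_add_four (K h : ℝ) (n : ℕ) : majorant K h (n + 4) = K * h ^ n *
    (majorant K h n + majorant K h (n + 1) + majorant K h (n + 2) + majorant K h (n + 3)) := by
  rw [majorant]

theorem majorant_nonneg {K h : ℝ} (hK : 0 ≤ K) (h0 : 0 ≤ h) (n : ℕ) : 0 ≤ majorant K h n := by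
  induction n using Nat.strong_induction_on with
  | _ n ih =>
    match n with
    | 0 | 1 | 2 => simp [majorant]
    | 3 => simp [majorant]
    | n + 4 =>
      have a0 := ih n (by omega)
      have a1 := ih (n + 1) (by omega)
      have a2 := ih (n + 2) (by omega)
      have a3 := ih (n + 3) (by omega)
      rw [majorant_add_four]
      positivity

end Majorant

/-! ### The entire solution of the three-term relation -/

section Coefficients

variable (a b h : ℂ)

/-- Coefficient of `Y` in `(1 - a Y) (1 - b Y) (1 - h Y / a) (1 - h Y / b)`. -/
noncomputable def e1 : ℂ := -(a + b) - h * (1 / a + 1 / b)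

/-- Coefficient of `Y ^ 2` in `(1 - a Y) (1 - b Y) (1 - h Y / a) (1 - h Y / b)`. -/
noncomputable def e2 : ℂ := a * b + h ^ 2 / (a * b) + h * (a + b) * (1 / a + 1 / b)

/-- Coefficient of `Y ^ 3` in `(1 - a Y) (1 - b Y) (1 - h Y / a) (1 - h Y / b)`. -/
noncomputable def e3 : ℂ := -((a + b) * h ^ 2 / (a * b)) - a * b * h * (1 / a + 1 / b)

/-- The polynomials in `t` which, up to the factor `(h ^ n t / h ^ 2; h)_∞` and a shift of the
index by `3`, are the coefficients of the solution of a first order `h`-difference equation. -/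
noncomputable def polyCoeff (t : ℂ) : ℕ → ℂ
  | 0 => 0
  | 1 => 0
  | 2 => 0
  | 3 => 1
  | n + 4 => h ^ n * (h / (1 - h ^ (n + 1)) *
      ((-t * h ^ 2 * (h ^ n / h ^ 3) * (1 - h ^ n * t) * (1 - h ^ n * t / h)
          * (1 - h ^ n * t / h ^ 2)) * polyCoeff t n +
        (-t * e3 a b h * (h ^ n / h ^ 2) * (1 - h ^ n * t) * (1 - h ^ n * t / h))
          * polyCoeff t (n + 1) +
        (-(1 + t + t * e2 a b h * (h ^ n / h)) * (1 - h ^ n * t)) * polyCoeff t (n + 2) +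
        (-t * e1 a b h * h ^ n) * polyCoeff t (n + 3)))

theorem polyCoeff_add_four (t : ℂ) (n : ℕ) : polyCoeff a b h t (n + 4) =
    h ^ n * (h / (1 - h ^ (n + 1)) *
      ((-t * h ^ 2 * (h ^ n / h ^ 3) * (1 - h ^ n * t) * (1 - h ^ n * t / h)
          * (1 - h ^ n * t / h ^ 2)) * polyCoeff a b h t n +
        (-t * e3 a b h * (h ^ n / h ^ 2) * (1 - h ^ n * t) * (1 - h ^ n * t / h))
          * polyCoeff a b h t (n + 1) +
        (-(1 + t + t * e2 a b h * (h ^ n / h)) * (1 - h ^ n * t)) * polyCoeff a b h t (n + 2) +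
        (-t * e1 a b h * h ^ n) * polyCoeff a b h t (n + 3))) := by
  rw [polyCoeff]

/-- The coefficients of the solution of a first order `h`-difference equation, with the index
shifted by `3`. -/
noncomputable def entireCoeff (t : ℂ) (n : ℕ) : ℂ :=
  qPochInf (h ^ n * t / h ^ 2) h * polyCoeff a b h t n

theorem differentiable_polyCoeff (n : ℕ) : Differentiable ℂ fun t => polyCoeff a b h t n := by
  induction n using Nat.strong_induction_on with
  | _ n ih =>
    match n with
    | 0 | 1 | 2 => simp [polyCoeff]
    | 3 => simp [polyCoeff]
    | n + 4 =>
      have a0 := ih n (by omega)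
      have a1 := ih (n + 1) (by omega)
      have a2 := ih (n + 2) (by omega)
      have a3 := ih (n + 3) (by omega)
      simp only [polyCoeff_add_four]
      fun_prop

variable {h}

theorem differentiable_entireCoeff (hh : ‖h‖ < 1) (n : ℕ) :
    Differentiable ℂ fun t => entireCoeff a b h t n := by
  have h1 := (differentiable_qPochInf hh).comp
    (show Differentiable ℂ fun t : ℂ => h ^ n * t / h ^ 2 by fun_prop)
  exact h1.mul (differentiable_polyCoeff a b h n)

theorem norm_polyCoeff_le (hh : ‖h‖ < 1) (T : ℝ) :
    ∃ K : ℝ, 0 ≤ K ∧ ∀ n t, ‖t‖ ≤ T → ‖polyCoeff a b h t n‖ ≤ majorant K ‖h‖ n := by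
  -- Treating `h ^ n` as an independent variable in the closed unit disc makes the recursion
  -- coefficients four fixed continuous functions on a compact set, hence bounded uniformly in `n`.
  let F0 : ℂ × ℂ → ℂ := fun w => -w.2 * h ^ 2 * (w.1 / h ^ 3) * (1 - w.1 * w.2)
    * (1 - w.1 * w.2 / h) * (1 - w.1 * w.2 / h ^ 2)
  let F1 : ℂ × ℂ → ℂ := fun w => -w.2 * e3 a b h * (w.1 / h ^ 2) * (1 - w.1 * w.2)
    * (1 - w.1 * w.2 / h)
  let F2 : ℂ × ℂ → ℂ := fun w => -(1 + w.2 + w.2 * e2 a b h * (w.1 / h)) * (1 - w.1 * w.2)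
  let F3 : ℂ × ℂ → ℂ := fun w => -w.2 * e1 a b h * w.1
  have c0 : Continuous F0 := by fun_prop
  have c1 : Continuous F1 := by fun_prop
  have c2 : Continuous F2 := by fun_prop
  have c3 : Continuous F3 := by fun_prop
  have hc : IsCompact (Metric.closedBall (0 : ℂ) 1 ×ˢ Metric.closedBall (0 : ℂ) T) :=
    (isCompact_closedBall _ _).prod (isCompact_closedBall _ _)
  obtain ⟨B0, hB0⟩ := hc.exists_bound_of_continuousOn c0.continuousOn
  obtain ⟨B1, hB1⟩ := hc.exists_bound_of_continuousOn c1.continuousOn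
  obtain ⟨B2, hB2⟩ := hc.exists_bound_of_continuousOn c2.continuousOn
  obtain ⟨B3, hB3⟩ := hc.exists_bound_of_continuousOn c3.continuousOn
  set B := |B0| + |B1| + |B2| + |B3| with hB
  have hd : 0 < 1 - ‖h‖ := by linarith
  have hBn : 0 ≤ B := by positivity
  refine ⟨1 / (1 - ‖h‖) * B, by positivity, fun n t ht => ?_⟩
  have hK : 0 ≤ 1 / (1 - ‖h‖) * B := by positivity
  induction n using Nat.strong_induction_on with
  | _ n ih =>
    match n with
    | 0 | 1 | 2 => simp [polyCoeff, majorant]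
    | 3 => simp [polyCoeff, majorant]
    | n + 4 =>
      have a0 := ih n (by omega)
      have a1 := ih (n + 1) (by omega)
      have a2 := ih (n + 2) (by omega)
      have a3 := ih (n + 3) (by omega)
      have hmem : (h ^ n, t) ∈ Metric.closedBall (0 : ℂ) 1 ×ˢ Metric.closedBall (0 : ℂ) T := by
        simp only [Set.mem_prod, mem_closedBall_zero_iff, norm_pow]
        exact ⟨pow_le_one₀ (norm_nonneg _) hh.le, ht⟩
      have b0 : ‖F0 (h ^ n, t)‖ ≤ B := (hB0 _ hmem).trans (by
        linarith [le_abs_self B0, abs_nonneg B1, abs_nonneg B2, abs_nonneg B3])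
      have b1 : ‖F1 (h ^ n, t)‖ ≤ B := (hB1 _ hmem).trans (by
        linarith [le_abs_self B1, abs_nonneg B0, abs_nonneg B2, abs_nonneg B3])
      have b2 : ‖F2 (h ^ n, t)‖ ≤ B := (hB2 _ hmem).trans (by
        linarith [le_abs_self B2, abs_nonneg B1, abs_nonneg B0, abs_nonneg B3])
      have b3 : ‖F3 (h ^ n, t)‖ ≤ B := (hB3 _ hmem).trans (by
        linarith [le_abs_self B3, abs_nonneg B1, abs_nonneg B2, abs_nonneg B0])
      have hq : ‖h / (1 - h ^ (n + 1))‖ ≤ 1 / (1 - ‖h‖) := by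
        rw [norm_div]
        have : 1 - ‖h‖ ≤ ‖1 - h ^ (n + 1)‖ := by
          have h2 := norm_sub_norm_le (1 : ℂ) (h ^ (n + 1))
          rw [norm_one, norm_pow] at h2
          have h3 : ‖h‖ ^ (n + 1) ≤ ‖h‖ := pow_le_of_le_one (norm_nonneg _) hh.le (by omega)
          linarith
        exact div_le_div₀ zero_le_one hh.le hd this
      rw [polyCoeff_add_four, majorant_add_four]
      change ‖h ^ n * (h / (1 - h ^ (n + 1)) * (F0 (h ^ n, t) * polyCoeff a b h t n
        + F1 (h ^ n, t) * polyCoeff a b h t (n + 1) + F2 (h ^ n, t) * polyCoeff a b h t (n + 2)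
        + F3 (h ^ n, t) * polyCoeff a b h t (n + 3)))‖ ≤ _
      rw [norm_mul, norm_mul, norm_pow]
      have hm : ∀ i, 0 ≤ majorant (1 / (1 - ‖h‖) * B) ‖h‖ i := majorant_nonneg hK (norm_nonneg _)
      set M := majorant (1 / (1 - ‖h‖) * B) ‖h‖ with hM
      have hsum : ‖F0 (h ^ n, t) * polyCoeff a b h t n
        + F1 (h ^ n, t) * polyCoeff a b h t (n + 1) + F2 (h ^ n, t) * polyCoeff a b h t (n + 2)
        + F3 (h ^ n, t) * polyCoeff a b h t (n + 3)‖ ≤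
          B * M n + B * M (n + 1) + B * M (n + 2) + B * M (n + 3) := by
        refine norm_add_le_of_le (norm_add_le_of_le (norm_add_le_of_le ?_ ?_) ?_) ?_ <;>
          rw [norm_mul]
        · exact mul_le_mul b0 a0 (norm_nonneg _) hBn
        · exact mul_le_mul b1 a1 (norm_nonneg _) hBn
        · exact mul_le_mul b2 a2 (norm_nonneg _) hBn
        · exact mul_le_mul b3 a3 (norm_nonneg _) hBn
      calc _ ≤ ‖h‖ ^ n * (1 / (1 - ‖h‖) * (B * M n + B * M (n + 1) + B * M (n + 2)
              + B * M (n + 3))) := by gcongr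
        _ = _ := by ring

/-- The majorant depends only on the bound `T` for `t`; this uniformity is what normal convergence
on compacta requires. -/
theorem norm_entireCoeff_le (hh : ‖h‖ < 1) (T : ℝ) :
    ∃ M : ℕ → ℝ, (∀ n t, ‖t‖ ≤ T → ‖entireCoeff a b h t n‖ ≤ M n) ∧
      ∀ R : ℝ, Summable fun n => M n * R ^ n := by
  obtain ⟨K, hK, hb⟩ := norm_polyCoeff_le a b hh T
  obtain ⟨Q, hQ⟩ := (isCompact_closedBall (0 : ℂ) (T / ‖h‖ ^ 2)).exists_bound_of_continuousOn
    (continuous_qPochInf hh).continuousOn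
  refine ⟨fun n => Q * majorant K ‖h‖ n, fun n t ht => ?_, fun R => ?_⟩
  · have hmem : h ^ n * t / h ^ 2 ∈ Metric.closedBall (0 : ℂ) (T / ‖h‖ ^ 2) := by
      rw [mem_closedBall_zero_iff, norm_div, norm_mul, norm_pow, norm_pow]
      have : ‖h‖ ^ n ≤ 1 := pow_le_one₀ (norm_nonneg _) hh.le
      have : ‖h‖ ^ n * ‖t‖ ≤ 1 * T := mul_le_mul this ht (norm_nonneg _) zero_le_one
      rw [one_mul] at this
      gcongr
    rw [entireCoeff, norm_mul]
    exact mul_le_mul (hQ _ hmem) (hb n t ht) (norm_nonneg _) ((norm_nonneg _).trans (hQ _ hmem))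
  · have := (summable_of_superexponential_recurrence (majorant_nonneg hK (norm_nonneg h))
      (norm_nonneg h) hh hK (fun n => (majorant_add_four K ‖h‖ n).le) R).mul_left Q
    simpa [mul_assoc] using this

theorem summable_entireCoeff (hh : ‖h‖ < 1) (t Y : ℂ) :
    Summable fun n => entireCoeff a b h t n * Y ^ n := by
  obtain ⟨M, hM, hs⟩ := norm_entireCoeff_le a b hh ‖t‖
  refine Summable.of_norm_bounded (hs ‖Y‖) fun n => ?_
  rw [norm_mul, norm_pow]
  exact mul_le_mul_of_nonneg_right (hM n t le_rfl) (by positivity)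

variable (h) in
/-- The entire solution of a first order `h`-difference equation. -/
noncomputable def entireSolution (t Y : ℂ) : ℂ :=
  ∑' r : ℕ, entireCoeff a b h t (r + 3) * Y ^ r

theorem one_sub_pow_ne_zero (hh : ‖h‖ < 1) (n : ℕ) : 1 - h ^ (n + 1) ≠ 0 := by
  intro H
  have h2 : ‖h ^ (n + 1)‖ < 1 := by
    rw [norm_pow]; exact pow_lt_one₀ (norm_nonneg _) hh (by omega)
  rw [← sub_eq_zero.1 H, norm_one] at h2
  exact lt_irrefl _ h2

/-- Comparing coefficients of `Y ^ r`, `r = n + 1`, in the three-term relation: the terms in the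
`r`-th coefficient collect to `t h^r + h^(-r) - 1 - t = h^(-r) (1 - h^r) (1 - h^r t)`. The possible
pole at `h^r t = 1` is harmless because `1 - h^r t` is the first factor of `(h^r t; h)_∞`. The
remaining ratios of shifted factorials are the products of `1 - h ^ n * t / h ^ i` in `polyCoeff`.
-/
theorem entireCoeff_recurrence (h0 : h ≠ 0) (hh : ‖h‖ < 1) (t : ℂ) (n : ℕ) :
    entireCoeff a b h t (n + 4) * (1 - h ^ (n + 1)) * (1 - h ^ (n + 1) * t) =
      -(h ^ (n + 1)) * ((1 + t) * entireCoeff a b h t (n + 2) +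
        t * (e1 a b h * h ^ n * entireCoeff a b h t (n + 3)
          + e2 a b h * (h ^ n / h) * entireCoeff a b h t (n + 2)
          + e3 a b h * (h ^ n / h ^ 2) * entireCoeff a b h t (n + 1)
          + h ^ 2 * (h ^ n / h ^ 3) * entireCoeff a b h t n)) := by
  have s : ∀ i, qPochInf (h ^ (n + i) * t / h ^ 2) h =
      (1 - h ^ (n + i) * t / h ^ 2) * qPochInf (h ^ (n + (i + 1)) * t / h ^ 2) h := by
    intro i
    rw [qPochInf_step hh]
    congr 2
    ring
  have s0 := s 0
  have s1 := s 1
  have s2 := s 2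
  have s3 := s 3
  norm_num only [add_zero] at s0 s1 s2 s3
  have hn := one_sub_pow_ne_zero hh n
  simp only [entireCoeff]
  rw [polyCoeff_add_four, s0, s1, s2, s3]
  generalize qPochInf (h ^ (n + 4) * t / h ^ 2) h = Q
  field_simp
  ring

theorem hasSum_shift {f : ℕ → ℂ} {Y σ : ℂ} (h0 : f 0 = 0)
    (hf : HasSum (fun n => f (n + 1) * Y ^ n) σ) : HasSum (fun n => f n * Y ^ n) (Y * σ) := by
  refine (hasSum_nat_add_iff' 1).1 ?_
  simp only [Finset.range_one, Finset.sum_singleton, h0, zero_mul, sub_zero]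
  refine (hf.mul_left Y).congr_fun fun n => ?_
  ring

/-- The first order `h`-difference equation. -/
theorem entireSolution_equation (ha : a ≠ 0) (hb : b ≠ 0) (h0 : h ≠ 0) (hh : ‖h‖ < 1)
    (t Y : ℂ) :
    t * ((1 - a * Y) * (1 - b * Y) * (1 - h * Y / a) * (1 - h * Y / b)) *
        entireSolution a b h t (h * Y) + entireSolution a b h t (Y / h) =
      (1 + t) * (1 - Y ^ 2) * entireSolution a b h t Y := by
  set c := entireCoeff a b h t with hc
  have c0 : c 0 = 0 := by simp [hc, entireCoeff, polyCoeff]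
  have c1 : c 1 = 0 := by simp [hc, entireCoeff, polyCoeff]
  have c2 : c 2 = 0 := by simp [hc, entireCoeff, polyCoeff]
  have S3 : ∀ y, HasSum (fun n => c (n + 3) * y ^ n) (entireSolution a b h t y) := by
    intro y
    refine Summable.hasSum ?_
    -- Undoing the index shift divides by `y ^ 3`, so the origin is separate; there only the
    -- constant term survives.
    by_cases hy : y = 0
    · subst hy
      refine summable_of_ne_finset_zero (s := {0}) fun n hn => ?_
      simp only [Finset.mem_singleton] at hn
      simp [hn]
    · have := ((summable_nat_add_iff 3).2 (summable_entireCoeff a b hh t y)).mul_left (1 / y ^ 3)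
      refine this.congr fun n => ?_
      field_simp
      ring
  -- The three zeros placed before the leading coefficient turn each index shift into a
  -- multiplication by `y`, without boundary terms.
  have S2 : ∀ y, HasSum (fun n => c (n + 2) * y ^ n) (y * entireSolution a b h t y) :=
    fun y => hasSum_shift (f := fun n => c (n + 2)) c2 (S3 y)
  have S1 : ∀ y, HasSum (fun n => c (n + 1) * y ^ n) (y * (y * entireSolution a b h t y)) :=
    fun y => hasSum_shift (f := fun n => c (n + 1)) c1 (S2 y)
  have S0 : ∀ y, HasSum (fun n => c n * y ^ n) (y * (y * (y * entireSolution a b h t y))) :=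
    fun y => hasSum_shift (f := c) c0 (S1 y)
  have S4 : ∀ y, HasSum (fun n => c (n + 4) * y ^ (n + 1)) (entireSolution a b h t y - c 3) := by
    intro y
    have := (hasSum_nat_add_iff' 1).2 (S3 y)
    simpa [add_assoc] using this
  -- `L` gathers the terms of the relation in which the degree is not raised, `R` all others. The
  -- constant terms drop out, since `1 - (1 + t) + t = 0`.
  have L := ((S4 (Y / h)).sub ((S4 Y).mul_left (1 + t))).add ((S4 (h * Y)).mul_left t)
  have R := (((S2 Y).mul_left (-(1 + t) * Y)).sub ((((((S3 (h * Y)).mul_left (e1 a b h * Y)).add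
    ((S2 (h * Y)).mul_left (e2 a b h * Y / h))).add
    ((S1 (h * Y)).mul_left (e3 a b h * Y / h ^ 2))).add
    ((S0 (h * Y)).mul_left (h ^ 2 * Y / h ^ 3))).mul_left t))
  have key := L.unique (R.congr_fun fun n => ?_)
  · have k1 : h ^ 2 * Y / h ^ 3 = Y / h := by field_simp
    simp only [e1, e2, e3] at key
    field_simp at key ⊢
    linear_combination key
  · have hrec := entireCoeff_recurrence a b h0 hh t n
    simp only [← hc] at hrec
    have hn : h ^ n ≠ 0 := pow_ne_zero _ h0
    rw [div_pow, mul_pow, mul_pow]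
    field_simp
    field_simp at hrec
    linear_combination Y ^ (n + 1) * hrec

end Coefficients

/-- Used to isolate the lowest coefficient of a difference of two solutions. -/
theorem tendsto_tsum_mul_pow_zero {d : ℕ → ℂ} (hd : Summable fun r => ‖d r‖) :
    Tendsto (fun Y : ℂ => ∑' r, d r * Y ^ r) (𝓝 0) (𝓝 (d 0)) := by
  have h0 : ∑' r, d r * (0 : ℂ) ^ r = d 0 := by
    rw [tsum_eq_single 0 fun r hr => by simp [hr]]
    simp
  rw [← h0]
  refine tendsto_tsum_of_dominated_convergence hd
    (fun r => (continuous_const.mul (continuous_pow r)).tendsto 0) ?_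
  filter_upwards [Metric.closedBall_mem_nhds (0 : ℂ) one_pos] with Y hY r
  rw [mem_closedBall_zero_iff] at hY
  rw [norm_mul, norm_pow]
  exact mul_le_of_le_one_right (norm_nonneg _) (pow_le_one₀ (norm_nonneg _) hY)

/-! ### Powers of `q` and the Askey--Wilson parameters -/

namespace Params

variable {P : Params}

section Power

theorem pow_zero' : P.pow 0 = 1 := by simp [pow]

theorem pow_neg' (x : ℂ) : P.pow (-x) = (P.pow x)⁻¹ := Complex.cpow_neg _ _

theorem pow_nat_mul (r : ℕ) (x : ℂ) : P.pow (r * x) = P.pow x ^ r :=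
  Complex.cpow_nat_mul _ _ _

variable (hq : 0 < P.q)
include hq

theorem pow_ne_zero' (x : ℂ) : P.pow x ≠ 0 := by
  simp [pow, Complex.cpow_eq_zero_iff, hq.ne']

theorem pow_add' (x y : ℂ) : P.pow (x + y) = P.pow x * P.pow y :=
  Complex.cpow_add _ _ (by exact_mod_cast hq.ne')

theorem pow_sub' (x y : ℂ) : P.pow (x - y) = P.pow x / P.pow y :=
  Complex.cpow_sub _ _ (by exact_mod_cast hq.ne')

theorem pow_two_mul (x : ℂ) : P.pow (2 * x) = P.pow x ^ 2 := by
  rw [two_mul, pow_add' hq, sq]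

theorem differentiable_pow : Differentiable ℂ P.pow := by
  unfold pow
  exact differentiable_id.const_cpow (Or.inl (by exact_mod_cast hq.ne'))

theorem pow_ofReal (x : ℝ) : P.pow x = ((P.q ^ x : ℝ) : ℂ) := by
  rw [pow, Complex.ofReal_cpow hq.le]

theorem norm_pow_ofReal (x : ℝ) : ‖P.pow x‖ = P.q ^ x := by
  rw [pow_ofReal hq, Complex.norm_real, Real.norm_of_nonneg (Real.rpow_nonneg hq.le _)]

theorem norm_pow_lt_one (hq1 : P.q < 1) {x : ℝ} (hx : 0 < x) : ‖P.pow x‖ < 1 := by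
  rw [norm_pow_ofReal hq]
  exact Real.rpow_lt_one hq.le hq1 hx

theorem tendsto_pow_atTop (hq1 : P.q < 1) : Tendsto (fun x : ℝ => P.pow x) atTop (𝓝 0) := by
  rw [tendsto_zero_iff_norm_tendsto_zero]
  simp only [norm_pow_ofReal hq]
  exact tendsto_rpow_atTop_of_base_lt_one _ (by linarith) hq1

theorem a_ne_zero : P.a ≠ 0 := pow_ne_zero' hq _

theorem b_ne_zero : P.b ≠ 0 := neg_ne_zero.2 (pow_ne_zero' hq _)

theorem c_ne_zero : P.c ≠ 0 := pow_ne_zero' hq _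

theorem d_ne_zero : P.d ≠ 0 := neg_ne_zero.2 (pow_ne_zero' hq _)

theorem dual_a_ne_zero : P.dual.a ≠ 0 := a_ne_zero (P := P.dual) hq

/-- This relation lets `A(-x)` be rewritten through the reciprocals of the parameters. -/
theorem mul_abcd : P.a * P.b * P.c * P.d = P.pow P.s * P.dual.a ^ 2 := by
  have e : P.a * P.b * P.c * P.d = P.pow (P.κ + P.lam) * P.pow (P.κ - P.lam)
      * P.pow (P.s / 2 + P.υ + P.ς) * P.pow (P.s / 2 + P.υ - P.ς) := by
    simp only [a, b, c, d]; ring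
  have e' : P.dual.a = P.pow (P.κ + P.υ) := rfl
  rw [e, e', sq, ← pow_add' hq, ← pow_add' hq, ← pow_add' hq, ← pow_add' hq, ← pow_add' hq]
  congr 1
  ring

end Power

/-! ### The difference equation with its prefactor divided out -/

section NormalizedEquation

/-- `(1 - Y / a) (1 - Y / b) (1 - Y / c) (1 - Y / d)`. -/
noncomputable def invFactor (P : Params) (Y : ℂ) : ℂ :=
  (1 - Y / P.a) * (1 - Y / P.b) * (1 - Y / P.c) * (1 - Y / P.d)

/-- The coefficient `A(x)` as a function of `Y = q ^ x`. -/
noncomputable def forwardCoeff (P : Params) (Y : ℂ) : ℂ :=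
  ((1 - P.a * Y) * (1 - P.b * Y) * (1 - P.c * Y) * (1 - P.d * Y)) /
    (P.dual.a * (1 - Y ^ 2) * (1 - P.pow P.s * Y ^ 2))

/-- The coefficient `A(-x)` as a function of `Y = q ^ x`. -/
noncomputable def backwardCoeff (P : Params) (Y : ℂ) : ℂ :=
  P.dual.a * P.invFactor Y / ((1 - Y ^ 2) * (1 - Y ^ 2 / P.pow P.s))

/-- The Askey-Wilson difference equation after division by the prefactor
`W(x, z) / (St(x) St^d(z))`, where `Y = q ^ x`, `t = q ^ z` and `SFwd`, `SBwd`, `Sx` are the values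
of the remaining factor at `x + s`, `x - s` and `x`. -/
noncomputable def normalizedEquation (P : Params) (Y t SFwd SBwd Sx : ℂ) : ℂ :=
  P.forwardCoeff Y * (P.dual.a * t * P.invFactor (P.pow P.s * Y) * SFwd - Sx) +
    P.backwardCoeff Y * (P.dual.a⁻¹ * t⁻¹ / P.invFactor Y * SBwd - Sx) +
    (-t - t⁻¹ + P.dual.a + P.dual.a⁻¹) * Sx

variable (hq : 0 < P.q) (hq1 : P.q < 1) (hs : 0 < P.s)
include hq

theorem A_eq (x : ℂ) : P.A x = P.forwardCoeff (P.pow x) := by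
  rw [A, forwardCoeff, pow_add' hq, pow_two_mul hq]

theorem A_neg_eq (x : ℂ) : P.A (-x) = P.backwardCoeff (P.pow x) := by
  have hX := pow_ne_zero' hq x
  have ha := a_ne_zero hq
  have hb := b_ne_zero hq
  have hc := c_ne_zero hq
  have hd := d_ne_zero hq
  have hã := dual_a_ne_zero hq
  have hp := pow_ne_zero' hq P.s
  have h4 := mul_abcd hq
  rw [A_eq hq, forwardCoeff, backwardCoeff, invFactor, pow_neg']
  generalize P.pow x = X at *
  generalize P.pow P.s = p at *
  generalize P.a = a at *
  generalize P.b = b at *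
  generalize P.c = c at *
  generalize P.d = d at *
  generalize P.dual.a = ã at *
  have n1 : (1 - a * X⁻¹) * (1 - b * X⁻¹) * (1 - c * X⁻¹) * (1 - d * X⁻¹) =
      p * ã ^ 2 / X ^ 4 * ((1 - X / a) * (1 - X / b) * (1 - X / c) * (1 - X / d)) := by
    rw [← h4]
    field_simp
    ring
  have n2 : ã * (1 - X⁻¹ ^ 2) * (1 - p * X⁻¹ ^ 2) =
      p * ã ^ 2 / X ^ 4 * (ã⁻¹ * ((1 - X ^ 2) * (1 - X ^ 2 / p))) := by
    field_simp
    ring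
  rw [n1, n2, mul_div_mul_left _ _ (by positivity), div_mul_eq_div_div]
  field_simp

omit hq in
theorem dual_a_eq : P.dual.a = P.pow (P.κ + P.υ) := rfl

include hs in
theorem W_add (x z : ℂ) : P.W (x + P.s) z = P.dual.a * P.pow z * P.W x z := by
  have : (P.s : ℂ) ≠ 0 := by exact_mod_cast hs.ne'
  rw [W, W, dual_a_eq, ← pow_add' hq, ← pow_add' hq]
  congr 1
  field_simp
  ring

include hs in
theorem W_sub (x z : ℂ) : P.W (x - P.s) z = P.dual.a⁻¹ * (P.pow z)⁻¹ * P.W x z := by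
  have h := W_add hq hs (x - P.s) z
  rw [sub_add_cancel] at h
  have := dual_a_ne_zero hq
  have := pow_ne_zero' hq z
  rw [h]
  field_simp

theorem W_ne_zero (x z : ℂ) : P.W x z ≠ 0 := pow_ne_zero' hq _

include hq1 hs

theorem norm_base_lt_one : ‖P.pow P.s‖ < 1 := norm_pow_lt_one hq hq1 hs

theorem St_eq_mul (x : ℂ) :
    P.St x = P.invFactor (P.pow P.s * P.pow x) * P.St (x + P.s) := by
  have hp := norm_base_lt_one hq hq1 hs
  have e : ∀ u : ℂ, qPochInf (P.pow (P.s + x) / u) (P.pow P.s) =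
      (1 - P.pow P.s * P.pow x / u) * qPochInf (P.pow (P.s + (x + P.s)) / u) (P.pow P.s) := by
    intro u
    rw [qPochInf_step hp, pow_add' hq, pow_add' hq, pow_add' hq]
    congr 2
    ring
  simp only [St, invFactor, e]
  ring

theorem St_sub (x : ℂ) : P.St (x - P.s) = P.invFactor (P.pow x) * P.St x := by
  have h := St_eq_mul hq hq1 hs (x - P.s)
  rwa [sub_add_cancel, ← pow_add' hq, add_sub_cancel] at h

/-- The difference equation for the full function in terms of the normalized equation. -/
theorem equation_eq_normalizedEquation (S : ℂ → ℂ) (x z : ℂ) (h₀ : P.St x ≠ 0)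
    (hBwd : P.St (x - P.s) ≠ 0) (hz : P.dual.St z ≠ 0) :
    P.D (fun y => P.W y z / (P.St y * P.dual.St z) * S y) x +
        (-P.pow z - P.pow (-z) + P.dual.a + P.dual.a⁻¹) *
          (P.W x z / (P.St x * P.dual.St z) * S x) =
      P.W x z / (P.St x * P.dual.St z) *
        P.normalizedEquation (P.pow x) (P.pow z) (S (x + P.s)) (S (x - P.s)) (S x) := by
  have hi : P.invFactor (P.pow x) ≠ 0 := by
    intro h
    rw [St_sub hq hq1 hs, h, zero_mul] at hBwd
    exact hBwd rfl
  have hf : P.invFactor (P.pow P.s * P.pow x) ≠ 0 := by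
    intro h
    rw [St_eq_mul hq hq1 hs, h, zero_mul] at h₀
    exact h₀ rfl
  have eFwd : P.St (x + P.s) = P.St x / P.invFactor (P.pow P.s * P.pow x) := by
    rw [St_eq_mul hq hq1 hs x, mul_div_cancel_left₀ _ hf]
  have hã := dual_a_ne_zero hq
  have ht := pow_ne_zero' hq z
  rw [D, A_eq hq, A_neg_eq hq, W_add hq hs, W_sub hq hs, eFwd, St_sub hq hq1 hs, pow_neg',
    normalizedEquation]
  field_simp

end NormalizedEquation

/-! ### Uniqueness of the coefficient functions -/

section Uniqueness

variable (hq : 0 < P.q) (hq1 : P.q < 1) (hs : 0 < P.s)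

theorem continuous_invFactor : Continuous P.invFactor := by
  unfold invFactor
  fun_prop

theorem IsAsymptoticallyFree.summable {Γ : ℕ → ℂ → ℂ} (h : P.IsAsymptoticallyFree Γ) (x z : ℂ) :
    Summable fun r : ℕ => ‖Γ r z * P.pow (r * x)‖ := by
  obtain ⟨M, hM, hb⟩ := h.normal {(x, z)} isCompact_singleton
  exact Summable.of_nonneg_of_le (fun _ => norm_nonneg _) (fun r => hb r (x, z) rfl) hM

theorem tendsto_backwardCoeff : Tendsto P.backwardCoeff (𝓝 0) (𝓝 P.dual.a) := by
  have : ContinuousAt P.backwardCoeff 0 := by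
    unfold backwardCoeff
    exact ContinuousAt.div (continuous_invFactor.continuousAt.const_mul _) (by fun_prop)
      (by simp)
  simpa [ContinuousAt, backwardCoeff, invFactor] using this

include hq

theorem tendsto_forwardCoeff : Tendsto P.forwardCoeff (𝓝 0) (𝓝 P.dual.a⁻¹) := by
  have hã := dual_a_ne_zero hq
  have : ContinuousAt P.forwardCoeff 0 := by
    unfold forwardCoeff
    exact ContinuousAt.div (by fun_prop) (by fun_prop) (by simpa using hã)
  simpa [ContinuousAt, forwardCoeff] using this

include hq1 hs

theorem eventually_St_ne_zero : ∀ᶠ x : ℝ in atTop, P.St x ≠ 0 := by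
  have hp := norm_base_lt_one hq hq1 hs
  have hc := continuous_qPochInf hp
  have ht := tendsto_pow_atTop hq hq1
  have key : ∀ u : ℂ, Tendsto (fun x : ℝ => qPochInf (P.pow (P.s + x) / u) (P.pow P.s)) atTop
      (𝓝 1) := by
    intro u
    have h1 : Tendsto (fun x : ℝ => P.pow (P.s + x) / u) atTop (𝓝 0) := by
      simp only [pow_add' hq]
      simpa using (ht.const_mul (P.pow P.s)).div_const u
    have h2 := (hc.tendsto 0).comp h1
    rwa [qPochInf_zero] at h2
  have := (((key P.a).mul (key P.b)).mul (key P.c)).mul (key P.d)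
  simp only [mul_one] at this
  exact this.eventually_ne one_ne_zero

/-- Two solutions with the same leading coefficient agree at `z` when the recursion for the
coefficients is regular at `z`. -/
theorem IsAsymptoticallyFree.eq_at {Γ Γ' : ℕ → ℂ → ℂ} (h : P.IsAsymptoticallyFree Γ)
    (h' : P.IsAsymptoticallyFree Γ') (z : ℂ) (hz : P.dual.St z ≠ 0) (ht1 : ‖P.pow z‖ < 1)
    (n : ℕ) : Γ n z = Γ' n z := by
  have hp1 := norm_base_lt_one hq hq1 hs
  have hp0 := pow_ne_zero' hq P.s
  have ht0 := pow_ne_zero' hq z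
  have hã := dual_a_ne_zero hq
  set p := P.pow P.s with hp
  set t := P.pow z with ht
  set d : ℕ → ℂ := fun r => Γ r z - Γ' r z with hd
  suffices H : d n = 0 from sub_eq_zero.1 H
  induction n using Nat.strong_induction_on with
  -- With all lower coefficients equal, the difference of the two series is `q ^ (n x)` times a
  -- power series `U` in `q ^ x` with constant term `d n`.
  | _ n ih =>
  rcases Nat.eq_zero_or_pos n with rfl | hn
  · simp only [hd, h.leading, h'.leading, sub_self]
  have hsumm : ∀ x : ℂ, Summable fun r : ℕ => ‖d r * P.pow x ^ r‖ := by
    intro x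
    refine Summable.of_nonneg_of_le (fun _ => norm_nonneg _) (fun r => ?_)
      ((h.summable x z).add (h'.summable x z))
    rw [← pow_nat_mul, hd, sub_mul]
    exact norm_sub_le _ _
  have hsd : Summable fun r => ‖d (r + n)‖ := by
    -- At `x = 0` one has `q ^ x = 1`, so convergence there is absolute summability of the
    -- coefficients.
    have := (summable_nat_add_iff n).2 (hsumm 0)
    simpa [pow_zero'] using this
  set U : ℂ → ℂ := fun Y => ∑' r, d (r + n) * Y ^ r with hU
  have hUlim : Tendsto U (𝓝 0) (𝓝 (d n)) := by
    simpa using tendsto_tsum_mul_pow_zero hsd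
  have hS : ∀ x : ℂ, P.series Γ x z - P.series Γ' x z = P.pow x ^ n * U (P.pow x) := by
    intro x
    have e : P.series Γ x z - P.series Γ' x z = ∑' r, d r * P.pow x ^ r := by
      rw [series, series, ← (h.summable x z).of_norm.tsum_sub (h'.summable x z).of_norm]
      refine tsum_congr fun r => ?_
      rw [pow_nat_mul, hd, sub_mul]
    rw [e, hU, ← tsum_mul_left, ← (hsumm x).of_norm.sum_add_tsum_nat_add n,
      Finset.sum_eq_zero fun i hi => by rw [ih i (Finset.mem_range.1 hi), zero_mul], zero_add]
    refine tsum_congr fun r => ?_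
    ring
  have hX := tendsto_pow_atTop hq hq1
  have heq : ∀ᶠ x : ℝ in atTop, P.normalizedEquation (P.pow x) t
      (p ^ n * U (p * P.pow x)) (U (P.pow x / p) / p ^ n) (U (P.pow x)) = 0 := by
    have hsh : ∀ᶠ x : ℝ in atTop, P.St ((x : ℂ) + P.s) ≠ 0 := by
      have := (tendsto_atTop_add_const_right atTop P.s tendsto_id).eventually
        (eventually_St_ne_zero hq hq1 hs)
      simpa using this
    have hsh' : ∀ᶠ x : ℝ in atTop, P.St ((x : ℂ) - P.s) ≠ 0 := by
      have := (tendsto_atTop_add_const_right atTop (-P.s) tendsto_id).eventually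
        (eventually_St_ne_zero hq hq1 hs)
      simpa [sub_eq_add_neg] using this
    have g1 : ∀ᶠ x : ℝ in atTop, P.pow (2 * x) ≠ 1 := by
      simp only [pow_two_mul hq]
      have := hX.pow 2
      exact this.eventually_ne (by simp)
    have g2 : ∀ᶠ x : ℝ in atTop, P.pow (P.s + 2 * x) ≠ 1 := by
      simp only [pow_add' hq, pow_two_mul hq]
      have := (hX.pow 2).const_mul (P.pow P.s)
      exact this.eventually_ne (by simp)
    have g3 : ∀ᶠ x : ℝ in atTop, P.pow (P.s - 2 * x) ≠ 1 := by
      have : ∀ᶠ x : ℝ in atTop, P.pow x ^ 2 ≠ P.pow P.s :=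
        (hX.pow 2).eventually_ne (by simpa using hp0.symm)
      filter_upwards [this] with x hx
      rw [pow_sub' hq, pow_two_mul hq]
      intro H
      rw [div_eq_one_iff_eq (pow_ne_zero 2 (pow_ne_zero' hq x))] at H
      exact hx H.symm
    filter_upwards [eventually_St_ne_zero hq hq1 hs, hsh, hsh', g1, g2, g3] with x h₀ hFwd hBwd k1 k2 k3
    have E := h.equation x z k1 k2 k3 h₀ hFwd hBwd hz
    have E' := h'.equation x z k1 k2 k3 h₀ hFwd hBwd hz
    simp only [ansatz] at E E'
    rw [equation_eq_normalizedEquation hq hq1 hs (fun y => P.series Γ y z) x z h₀ hBwd hz] at E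
    rw [equation_eq_normalizedEquation hq hq1 hs (fun y => P.series Γ' y z) x z h₀ hBwd hz] at E'
    have hW : P.W x z / (P.St x * P.dual.St z) ≠ 0 :=
      div_ne_zero (W_ne_zero hq _ _) (mul_ne_zero h₀ hz)
    have E1 := (mul_eq_zero.1 E).resolve_left hW
    have E1' := (mul_eq_zero.1 E').resolve_left hW
    have sFwd := hS (x + P.s)
    have sBwd := hS (x - P.s)
    have s₀ := hS x
    rw [pow_add' hq, mul_comm (P.pow x), ← hp, mul_pow] at sFwd
    rw [pow_sub' hq, ← hp, div_pow] at sBwd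
    have hXn : P.pow x ^ n ≠ 0 := pow_ne_zero n (pow_ne_zero' hq x)
    refine (mul_eq_zero.1 (?_ : P.pow x ^ n * _ = 0)).resolve_left hXn
    have hlin : P.pow x ^ n * P.normalizedEquation (P.pow x) t
      (p ^ n * U (p * P.pow x)) (U (P.pow x / p) / p ^ n) (U (P.pow x)) =
      P.normalizedEquation (P.pow x) t (p ^ n * P.pow x ^ n * U (p * P.pow x))
        (P.pow x ^ n / p ^ n * U (P.pow x / p)) (P.pow x ^ n * U (P.pow x)) := by
      simp only [normalizedEquation]; ring
    rw [hlin, ← sFwd, ← sBwd, ← s₀]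
    simp only [normalizedEquation] at E1 E1' ⊢
    linear_combination E1 - E1'
  -- As `x → +∞` the two coefficients of the operator tend to the inverse of `P.dual.a` and to
  -- `P.dual.a`, and `invFactor` tends to 1. The limit of the equation is the indicial equation for
  -- `d n`.
  have hlim : Tendsto (fun x : ℝ => P.normalizedEquation (P.pow x) t
      (p ^ n * U (p * P.pow x)) (U (P.pow x / p) / p ^ n) (U (P.pow x))) atTop
      (𝓝 (P.dual.a⁻¹ * (P.dual.a * t * P.invFactor 0 * (p ^ n * d n) - d n) +
        P.dual.a * (P.dual.a⁻¹ * t⁻¹ / P.invFactor 0 * (d n / p ^ n) - d n) +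
        (-t - t⁻¹ + P.dual.a + P.dual.a⁻¹) * d n)) := by
    have i0 : P.invFactor 0 = 1 := by simp [invFactor]
    have hpX : Tendsto (fun x : ℝ => p * P.pow x) atTop (𝓝 0) := by simpa using hX.const_mul p
    have hXp : Tendsto (fun x : ℝ => P.pow x / p) atTop (𝓝 0) := by simpa using hX.div_const p
    have ci := (continuous_invFactor (P := P)).tendsto 0
    have u0 := hUlim.comp hX
    have u1 := (hUlim.comp hpX).const_mul (p ^ n)
    have u2 := (hUlim.comp hXp).div_const (p ^ n)
    have f1 := (tendsto_forwardCoeff hq).comp hX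
    have f2 := (tendsto_backwardCoeff (P := P)).comp hX
    refine ((f1.mul ((((ci.comp hpX).const_mul (P.dual.a * t)).mul u1).sub u0)).add
      (f2.mul (((((tendsto_const_nhds (x := P.dual.a⁻¹ * t⁻¹)).div (ci.comp hX)
        (by rw [i0]; exact one_ne_zero))).mul u2).sub u0))).add
      (u0.const_mul (-t - t⁻¹ + P.dual.a + P.dual.a⁻¹))
  have hzero := tendsto_nhds_unique hlim (tendsto_const_nhds.congr' (heq.mono fun x hx => hx.symm))
  have i0 : P.invFactor 0 = 1 := by simp [invFactor]
  have hpn : p ^ n ≠ 0 := pow_ne_zero n hp0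
  have hpn1 : ‖p ^ n‖ < 1 := by
    rw [norm_pow]; exact pow_lt_one₀ (norm_nonneg _) hp1 (by omega)
  have n1 : 1 - p ^ n ≠ 0 := by
    intro H
    rw [← sub_eq_zero.1 H, norm_one] at hpn1
    exact lt_irrefl _ hpn1
  -- Here `‖t‖ < 1` excludes resonance: the indicial polynomial is `(1 - p ^ n) (1 - p ^ n t ^ 2)`,
  -- up to the factor `1 / (p ^ n t)`.
  have n2 : 1 - p ^ n * t ^ 2 ≠ 0 := by
    intro H
    have : ‖p ^ n * t ^ 2‖ < 1 := by
      rw [norm_mul, norm_pow t]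
      exact mul_lt_one_of_nonneg_of_lt_one_left (norm_nonneg _) hpn1
        (pow_le_one₀ (norm_nonneg _) ht1.le)
    rw [← sub_eq_zero.1 H, norm_one] at this
    exact lt_irrefl _ this
  rw [i0] at hzero
  rw [show P.dual.a⁻¹ * (P.dual.a * t * 1 * (p ^ n * d n) - d n) +
      P.dual.a * (P.dual.a⁻¹ * t⁻¹ / 1 * (d n / p ^ n) - d n) +
      (-t - t⁻¹ + P.dual.a + P.dual.a⁻¹) * d n =
      (1 - p ^ n) * (1 - p ^ n * t ^ 2) * d n / (p ^ n * t) by field_simp; ring,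
    div_eq_zero_iff] at hzero
  have := hzero.resolve_right (mul_ne_zero hpn ht0)
  exact (mul_eq_zero.1 this).resolve_left (mul_ne_zero n1 n2)

theorem IsAsymptoticallyFree.unique {Γ Γ' : ℕ → ℂ → ℂ} (h : P.IsAsymptoticallyFree Γ)
    (h' : P.IsAsymptoticallyFree Γ') : Γ = Γ' := by
  -- For real `z ≥ Z` the recursion is regular. Such points accumulate at `Z`, and the coefficients
  -- are entire, so the identity theorem covers the exceptional `z`.
  obtain ⟨Z, hZ⟩ := eventually_atTop.1
    ((eventually_St_ne_zero (P := P.dual) hq hq1 hs).and (eventually_gt_atTop 0))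
  funext r
  have hA : AnalyticOnNhd ℂ (Γ r) Set.univ := fun z _ => (h.holomorphic r).analyticAt z
  have hA' : AnalyticOnNhd ℂ (Γ' r) Set.univ := fun z _ => (h'.holomorphic r).analyticAt z
  refine hA.eq_of_frequently_eq hA' (z₀ := (Z : ℂ)) ?_
  have hseq : Tendsto (fun n : ℕ => ((Z + 1 / ((n : ℝ) + 1) : ℝ) : ℂ)) atTop (𝓝[≠] (Z : ℂ)) := by
    refine tendsto_nhdsWithin_iff.2 ⟨?_, .of_forall fun n => ?_⟩
    · refine (Complex.continuous_ofReal.tendsto Z).comp ?_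
      simpa using (tendsto_one_div_add_atTop_nhds_zero_nat (𝕜 := ℝ)).const_add Z
    · simp only [Set.mem_compl_iff, Set.mem_singleton_iff, Complex.ofReal_inj]
      have : 0 < 1 / ((n : ℝ) + 1) := by positivity
      linarith
  refine hseq.frequently (.of_forall fun n => ?_)
  have hle : Z ≤ Z + 1 / ((n : ℝ) + 1) := by
    have : 0 < 1 / ((n : ℝ) + 1) := by positivity
    linarith
  obtain ⟨hSt, hpos⟩ := hZ _ hle
  exact h.eq_at hq hq1 hs h' _ hSt (norm_pow_lt_one hq hq1 hpos) r

theorem IsAsymptoticallyFree.Gam_eq {Γ : ℕ → ℂ → ℂ} (h : P.IsAsymptoticallyFree Γ) :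
    P.Gam = Γ :=
  (Classical.epsilon_spec (p := P.IsAsymptoticallyFree) ⟨Γ, h⟩).unique hq hq1 hs h

end Uniqueness

end Params

/-! ### Power series used for the coefficient functions -/

section Expansion

variable {h : ℂ}

theorem exists_coeff_qPochInf_sq (hh : ‖h‖ < 1) : ∃ β : ℕ → ℂ, β 0 = 1 ∧
    ∀ Y : ℂ, (Summable fun n => ‖β n * Y ^ n‖) ∧
      ∑' n, β n * Y ^ n = qPochInf (h * Y ^ 2) (h ^ 2) := by
  set f : ℂ → ℂ := fun Y => qPochInf (h * Y ^ 2) (h ^ 2) with hf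
  have hd : Differentiable ℂ f := (differentiable_qPochInf (norm_sq_lt_one hh)).comp
    (show Differentiable ℂ fun Y : ℂ => h * Y ^ 2 by fun_prop)
  have hsum : ∀ Y, HasSum (fun n : ℕ => (n.factorial : ℂ)⁻¹ * iteratedDeriv n f 0 * Y ^ n) (f Y) := by
    intro Y
    have := Complex.hasSum_taylorSeries_of_entire hd 0 Y
    simpa [mul_assoc, mul_comm, mul_left_comm] using this
  refine ⟨fun n => (n.factorial : ℂ)⁻¹ * iteratedDeriv n f 0, ?_, fun Y => ⟨?_, (hsum Y).tsum_eq⟩⟩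
  · simp [hf, qPochInf_zero]
  · exact (hsum Y).summable.norm

theorem norm_entireCoeff_shift_le (a b : ℂ) (hh : ‖h‖ < 1) (T : ℝ) :
    ∃ M : ℕ → ℝ, (∀ n t, ‖t‖ ≤ T → ‖entireCoeff a b h t (n + 3)‖ ≤ M n) ∧
      ∀ R : ℝ, 0 < R → Summable fun n => M n * R ^ n := by
  obtain ⟨M, hM, hs⟩ := norm_entireCoeff_le a b hh T
  refine ⟨fun n => M (n + 3), fun n t ht => hM _ t ht, fun R hR => ?_⟩
  refine (((summable_nat_add_iff 3).2 (hs R)).mul_right (1 / R ^ 3)).congr fun n => ?_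
  field_simp
  ring

theorem summable_entireCoeff_shift (a b : ℂ) (hh : ‖h‖ < 1) (t Y : ℂ) :
    Summable fun n => ‖entireCoeff a b h t (n + 3) * Y ^ n‖ := by
  obtain ⟨M, hM, hs⟩ := norm_entireCoeff_shift_le a b hh ‖t‖
  refine Summable.of_nonneg_of_le (fun _ => norm_nonneg _) (fun n => ?_)
    (hs (‖Y‖ + 1) (by positivity))
  rw [norm_mul, norm_pow]
  have h1 := hM n t le_rfl
  have h2 : ‖Y‖ ^ n ≤ (‖Y‖ + 1) ^ n := by gcongr; linarith
  exact mul_le_mul h1 h2 (by positivity) ((norm_nonneg _).trans h1)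

theorem entireCoeff_three (a b : ℂ) (h0 : h ≠ 0) (t : ℂ) :
    entireCoeff a b h t 3 = qPochInf (h * t) h := by
  rw [entireCoeff, polyCoeff, mul_one]
  congr 1
  field_simp

end Expansion

/-! ### Parameters, singular terms and `W` for the two specializations -/

section Specializations

variable (κ lam s q : ℝ)

/-- `q ^ (s / 2)`, the base of the smaller step-size. -/
noncomputable def halfBase : ℂ := (paramsJ κ lam s q).pow (s / 2)

/-- `q ^ (s / 4)`. -/
noncomputable def quarterBase : ℂ := (paramsJ κ lam s q).pow (s / 4)

/-- `q ^ κ`. -/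
noncomputable def powκ : ℂ := (paramsJ κ lam s q).pow κ

/-- `q ^ lam`. -/
noncomputable def powLam : ℂ := (paramsJ κ lam s q).pow lam

local notation "J" => paramsJ κ lam s q
local notation "R" => paramsR κ lam s q
local notation "h" => halfBase κ lam s q
local notation "w" => quarterBase κ lam s q
local notation "α" => powκ κ lam s q
local notation "μ" => powLam κ lam s q

variable {κ lam s q}
variable (hs : 0 < s) (hq0 : 0 < q) (hq1 : q < 1)

theorem paramsR_pow (x : ℂ) : (R).pow x = (J).pow x := rfl

theorem paramsR_a : (R).a = (J).a := rfl

theorem paramsR_b : (R).b = (J).b := rfl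

theorem paramsR_base : (R).pow (R).s = h := by
  change (J).pow ((s / 2 : ℝ) : ℂ) = (J).pow (s / 2)
  push_cast
  rfl

include hq0

theorem halfBase_ne_zero : h ≠ 0 := Params.pow_ne_zero' (P := J) hq0 _

theorem quarterBase_ne_zero : w ≠ 0 := Params.pow_ne_zero' (P := J) hq0 _

theorem powκ_ne_zero : α ≠ 0 := Params.pow_ne_zero' (P := J) hq0 _

theorem powLam_ne_zero : μ ≠ 0 := Params.pow_ne_zero' (P := J) hq0 _

theorem paramsJ_base : (J).pow (J).s = h ^ 2 := by
  rw [halfBase, sq, ← Params.pow_add' (P := J) hq0]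
  congr 1
  change (s : ℂ) = s / 2 + s / 2
  ring

theorem quarterBase_sq : w ^ 2 = h := by
  rw [quarterBase, halfBase, sq, ← Params.pow_add' (P := J) hq0]
  congr 1
  ring

theorem paramsJ_a : (J).a = α * μ := Params.pow_add' (P := J) hq0 _ _

theorem paramsJ_b : (J).b = -(α / μ) := congrArg Neg.neg (Params.pow_sub' (P := J) hq0 _ _)

theorem paramsJ_c : (J).c = h * (J).a := by
  change (J).pow (s / 2 + κ + lam) = (J).pow (s / 2) * (J).pow (κ + lam)
  rw [← Params.pow_add' (P := J) hq0, add_assoc]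

theorem paramsJ_d : (J).d = h * (J).b := by
  change -(J).pow (s / 2 + κ - lam) = (J).pow (s / 2) * -(J).pow (κ - lam)
  rw [mul_neg, ← Params.pow_add' (P := J) hq0, add_sub_assoc]

theorem paramsJ_dual_a : (J).dual.a = α ^ 2 := by
  rw [sq]
  exact Params.pow_add' (P := J) hq0 _ _

omit hq0 in
theorem paramsR_c : (R).c = w := by
  change (J).pow (((s / 2 : ℝ) : ℂ) / 2 + ((0 : ℝ) : ℂ) + ((0 : ℝ) : ℂ)) = (J).pow (s / 4)
  congr 1
  push_cast
  ring

omit hq0 in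
theorem paramsR_d : (R).d = -w := by
  change -(J).pow (((s / 2 : ℝ) : ℂ) / 2 + ((0 : ℝ) : ℂ) - ((0 : ℝ) : ℂ)) = -(J).pow (s / 4)
  congr 2
  push_cast
  ring

omit hq0 in
theorem paramsR_dual_a : (R).dual.a = α := by
  change (J).pow (κ + ((0 : ℝ) : ℂ)) = (J).pow κ
  congr 1
  push_cast
  ring

include hs hq1

theorem norm_halfBase_lt_one : ‖h‖ < 1 := by
  have := Params.norm_pow_lt_one (P := J) hq0 hq1 (x := s / 2) (by linarith)
  push_cast at this
  exact this

/-- As `c = h a` and `d = h b`, the four products of base `h ^ 2` are the even and odd halves of two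
products of base `h`. -/
theorem paramsJ_St (x : ℂ) : (J).St x =
    qPochInf (h * (J).pow x / (J).a) h * qPochInf (h * (J).pow x / (J).b) h := by
  have hh := norm_halfBase_lt_one (κ := κ) (lam := lam) hs hq0 hq1
  have h0 := halfBase_ne_zero (κ := κ) (lam := lam) (s := s) hq0
  have ha : (J).a ≠ 0 := Params.a_ne_zero (P := J) hq0
  have hb : (J).b ≠ 0 := Params.b_ne_zero (P := J) hq0
  rw [Params.St, Params.pow_add' (P := J) hq0, paramsJ_base hq0, paramsJ_c hq0, paramsJ_d hq0,
    ← qPochInf_even_mul_odd hh (h * (J).pow x / (J).a),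
    ← qPochInf_even_mul_odd hh (h * (J).pow x / (J).b)]
  rw [show h ^ 2 * (J).pow x / (h * (J).a) = h * (J).pow x / (J).a by field_simp,
    show h ^ 2 * (J).pow x / (h * (J).b) = h * (J).pow x / (J).b by field_simp,
    show h * (J).pow x / (J).a * h = h ^ 2 * (J).pow x / (J).a by ring,
    show h * (J).pow x / (J).b * h = h ^ 2 * (J).pow x / (J).b by ring]
  ring

/-- The extra factor comes from `c = -d`, through `(u; h)_∞ (-u; h)_∞ = (u ^ 2; h ^ 2)_∞`. -/
theorem paramsR_St (x : ℂ) : (R).St x = (J).St x * qPochInf (h * (J).pow x ^ 2) (h ^ 2) := by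
  have hh := norm_halfBase_lt_one (κ := κ) (lam := lam) hs hq0 hq1
  have h0 := halfBase_ne_zero (κ := κ) (lam := lam) (s := s) hq0
  have w0 := quarterBase_ne_zero (κ := κ) (lam := lam) (s := s) hq0
  have hw := quarterBase_sq (κ := κ) (lam := lam) (s := s) hq0
  rw [paramsJ_St hs hq0 hq1, Params.St, Params.pow_add' (P := R) hq0, paramsR_base, paramsR_c,
    paramsR_d, paramsR_a, paramsR_b, paramsR_pow, div_neg, mul_assoc, qPochInf_mul_neg hh, div_pow,
    hw, show (h * (J).pow x) ^ 2 / h = h * (J).pow x ^ 2 by field_simp]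

/-- The dual parameters are `α ^ 2, -1, h μ ^ 2, -h` on the left and `α, -α, w μ, -w μ` on the
right. The two opposite pairs merge into the products of base `h ^ 2` for `α ^ 2` and `h μ ^ 2`;
those for `-1` and `-h` are the odd and even halves of the extra factor. -/
theorem paramsJ_dual_St (z : ℂ) : (J).dual.St z =
    (R).dual.St (z / 2) * qPochInf (-(h * (J).pow z)) h := by
  have hh := norm_halfBase_lt_one (κ := κ) (lam := lam) hs hq0 hq1
  have h0 := halfBase_ne_zero (κ := κ) (lam := lam) (s := s) hq0
  have w0 := quarterBase_ne_zero (κ := κ) (lam := lam) (s := s) hq0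
  have hw := quarterBase_sq (κ := κ) (lam := lam) (s := s) hq0
  have α0 := powκ_ne_zero (κ := κ) (lam := lam) (s := s) hq0
  have μ0 := powLam_ne_zero (κ := κ) (lam := lam) (s := s) hq0
  have hadd := Params.pow_add' (P := J) hq0
  have jb : (J).dual.b = -1 := by
    change -(J).pow (κ - κ) = -1
    rw [sub_self, Params.pow_zero']
  have jc : (J).dual.c = h * μ ^ 2 := by
    change (J).pow (s / 2 + lam + lam) = _
    rw [hadd, hadd, mul_assoc, sq]
    rfl
  have jd : (J).dual.d = -h := by
    change -(J).pow (s / 2 + lam - lam) = -(J).pow (s / 2)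
    rw [add_sub_cancel_right]
  have rb : (R).dual.b = -α := by
    change -(J).pow (κ - ((0 : ℝ) : ℂ)) = -(J).pow κ
    simp
  have rc : (R).dual.c = w * μ := by
    change (J).pow (((s / 2 : ℝ) : ℂ) / 2 + lam + ((0 : ℝ) : ℂ)) = _
    rw [quarterBase, powLam, ← hadd]
    congr 1
    push_cast
    ring
  have rd : (R).dual.d = -(w * μ) := by
    change -(J).pow (((s / 2 : ℝ) : ℂ) / 2 + lam - ((0 : ℝ) : ℂ)) = _
    rw [quarterBase, powLam, ← hadd]
    congr 2
    push_cast
    ring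
  have rbase : (R).dual.pow (R).dual.s = h := paramsR_base
  have jbase : (J).dual.pow (J).dual.s = h ^ 2 := paramsJ_base hq0
  have ht : (J).pow (z / 2) ^ 2 = (J).pow z := by
    rw [← Params.pow_two_mul (P := J) hq0]
    congr 1
    ring
  rw [Params.St, Params.St, Params.pow_add' (P := (R).dual) hq0, Params.pow_add' (P := (J).dual) hq0,
    rbase, jbase, jb, jc, jd, rb, rc, rd, paramsJ_dual_a hq0, paramsR_dual_a, div_neg, div_neg,
    div_neg, div_neg, qPochInf_mul_neg hh, mul_assoc (qPochInf ((h * (R).dual.pow (z / 2) / α) ^ 2) (h ^ 2)),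
    qPochInf_mul_neg hh,
    ← qPochInf_even_mul_odd hh (-(h * (J).pow z))]
  change qPochInf (h ^ 2 * (J).pow z / α ^ 2) (h ^ 2) * qPochInf (-(h ^ 2 * (J).pow z / 1)) (h ^ 2) *
    qPochInf (h ^ 2 * (J).pow z / (h * μ ^ 2)) (h ^ 2) * qPochInf (-(h ^ 2 * (J).pow z / h)) (h ^ 2) =
    qPochInf ((h * (J).pow (z / 2) / α) ^ 2) (h ^ 2) *
      qPochInf ((h * (J).pow (z / 2) / (w * μ)) ^ 2) (h ^ 2) *
      (qPochInf (-(h * (J).pow z)) (h ^ 2) * qPochInf (-(h * (J).pow z) * h) (h ^ 2))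
  rw [div_pow, mul_pow, ht, div_pow, mul_pow, mul_pow, ht, hw,
    show h ^ 2 * (J).pow z / (h * μ ^ 2) = h * (J).pow z / μ ^ 2 by field_simp,
    show h ^ 2 * (J).pow z / h = h * (J).pow z by field_simp,
    show -(h * (J).pow z) * h = -(h ^ 2 * (J).pow z / 1) by ring]
  ring

omit hs hq0 hq1 in
theorem paramsR_W (hs' : s ≠ 0) (x z : ℂ) : (R).W x (z / 2) = (J).W x z := by
  have : (s : ℂ) ≠ 0 := by exact_mod_cast hs'
  change (J).pow ((κ + lam + x) * (κ + ((0 : ℝ) : ℂ) + z / 2) / ((s / 2 : ℝ) : ℂ)) =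
    (J).pow ((κ + lam + x) * (κ + κ + z) / s)
  congr 1
  push_cast
  field_simp
  ring

end Specializations

/-! ### From step `h` to step `h ^ 2` -/

section Algebra

/-- Composing the first order equation with itself: the equation of the step-size `s` operator. -/
theorem second_order_of_first_order {a α h X t H H1 H2 Hm Hm2 : ℂ} (ha : a ≠ 0) (hα : α ≠ 0)
    (hh : h ≠ 0) (ht : t ≠ 0) (d0 : 1 - X ^ 2 ≠ 0) (d1 : 1 - h ^ 2 * X ^ 2 ≠ 0)
    (d2 : 1 - X ^ 2 / h ^ 2 ≠ 0)
    (E0 : t * ((1 - a * X) * (1 + α ^ 2 / a * X) * (1 - h * X / a) * (1 + h * X * a / α ^ 2)) * H1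
      + Hm = (1 + t) * (1 - X ^ 2) * H)
    (E1 : t * ((1 - a * (h * X)) * (1 + α ^ 2 / a * (h * X)) * (1 - h * (h * X) / a) *
      (1 + h * (h * X) * a / α ^ 2)) * H2 + H = (1 + t) * (1 - (h * X) ^ 2) * H1)
    (Em : t * ((1 - a * (X / h)) * (1 + α ^ 2 / a * (X / h)) * (1 - h * (X / h) / a) *
      (1 + h * (X / h) * a / α ^ 2)) * H + Hm2 = (1 + t) * (1 - (X / h) ^ 2) * Hm) :
    t * ((1 - a * X) * (1 + α ^ 2 / a * X) * (1 - h * a * X) * (1 + h * (α ^ 2 / a) * X)) *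
        ((1 - h ^ 2 * X / a) * (1 + h ^ 2 * X * a / α ^ 2) * (1 - h * X / a)
          * (1 + h * X * a / α ^ 2)) / ((1 - X ^ 2) * (1 - h ^ 2 * X ^ 2)) * H2 +
      t⁻¹ / ((1 - X ^ 2) * (1 - X ^ 2 / h ^ 2)) * Hm2 =
    ((1 - a * X) * (1 + α ^ 2 / a * X) * (1 - h * a * X) * (1 + h * (α ^ 2 / a) * X) /
        (α ^ 2 * (1 - X ^ 2) * (1 - h ^ 2 * X ^ 2)) +
      α ^ 2 * ((1 - X / a) * (1 + X * a / α ^ 2) * (1 - X / (h * a)) * (1 + X * a / (h * α ^ 2))) /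
        ((1 - X ^ 2) * (1 - X ^ 2 / h ^ 2)) + t + t⁻¹ - α ^ 2 - (α ^ 2)⁻¹) * H := by
  -- The relations at `X / h` and `h X` trade the outer values `Hm2`, `H2` for the inner ones `Hm`,
  -- `H1` and for `H`; the relation at `X` then eliminates the inner ones together (`e3`). What is
  -- left is the identity `e4` between the coefficients of `H`.
  have hHm2 : Hm2 = (1 + t) * (1 - X ^ 2 / h ^ 2) * Hm -
      t * ((1 - a * (X / h)) * (1 + α ^ 2 / a * (X / h)) * (1 - X / a) *
      (1 + X * a / α ^ 2)) * H := by
    rw [← div_pow, show X / a = h * (X / h) / a by field_simp,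
      show X * a / α ^ 2 = h * (X / h) * a / α ^ 2 by field_simp]
    linear_combination Em
  have hH2 : t * ((1 - a * (h * X)) * (1 + α ^ 2 / a * (h * X)) * (1 - h * (h * X) / a) *
      (1 + h * (h * X) * a / α ^ 2)) * H2 / (1 - h ^ 2 * X ^ 2) =
      (1 + t) * H1 - H / (1 - h ^ 2 * X ^ 2) := by
    rw [eq_sub_iff_add_eq, ← add_div, div_eq_iff d1]
    linear_combination E1
  have hHm : Hm = (1 + t) * (1 - X ^ 2) * H -
      t * ((1 - a * X) * (1 + α ^ 2 / a * X) * (1 - h * X / a) * (1 + h * X * a / α ^ 2)) * H1 := by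
    linear_combination E0
  have e1 : t * ((1 - a * X) * (1 + α ^ 2 / a * X) * (1 - h * a * X) * (1 + h * (α ^ 2 / a) * X)) *
        ((1 - h ^ 2 * X / a) * (1 + h ^ 2 * X * a / α ^ 2) * (1 - h * X / a)
          * (1 + h * X * a / α ^ 2)) / ((1 - X ^ 2) * (1 - h ^ 2 * X ^ 2)) * H2 =
      (1 - a * X) * (1 + α ^ 2 / a * X) * (1 - h * X / a) * (1 + h * X * a / α ^ 2) / (1 - X ^ 2) *
      ((1 + t) * H1 - H / (1 - h ^ 2 * X ^ 2)) := by
    rw [← hH2, show a * (h * X) = h * a * X by ring,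
      show α ^ 2 / a * (h * X) = h * (α ^ 2 / a) * X by ring,
      show h * (h * X) / a = h ^ 2 * X / a by ring,
      show h * (h * X) * a / α ^ 2 = h ^ 2 * X * a / α ^ 2 by ring]
    generalize 1 - h ^ 2 * X ^ 2 = B
    generalize 1 - X ^ 2 = A
    generalize 1 - a * X = f1
    generalize 1 + α ^ 2 / a * X = f2
    generalize 1 - h * a * X = f3
    generalize 1 + h * (α ^ 2 / a) * X = f4
    generalize 1 - h ^ 2 * X / a = f5
    generalize 1 + h ^ 2 * X * a / α ^ 2 = f6
    generalize 1 - h * X / a = f7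
    generalize 1 + h * X * a / α ^ 2 = f8
    ring
  have e2 : t⁻¹ / ((1 - X ^ 2) * (1 - X ^ 2 / h ^ 2)) * Hm2 = t⁻¹ / (1 - X ^ 2) * ((1 + t) * Hm) -
      (1 - a * (X / h)) * (1 + α ^ 2 / a * (X / h)) * (1 - X / a) * (1 + X * a / α ^ 2) /
        ((1 - X ^ 2) * (1 - X ^ 2 / h ^ 2)) * H := by
    rw [hHm2]
    generalize 1 - X ^ 2 / h ^ 2 = D at *
    field_simp
  have e3 : (1 - a * X) * (1 + α ^ 2 / a * X) * (1 - h * X / a) * (1 + h * X * a / α ^ 2)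
        / (1 - X ^ 2) * ((1 + t) * H1) + t⁻¹ / (1 - X ^ 2) * ((1 + t) * Hm) =
      t⁻¹ * (1 + t) ^ 2 * H := by
    rw [hHm]
    field_simp
    ring
  have e4 : (1 - a * X) * (1 + α ^ 2 / a * X) * (1 - h * X / a) * (1 + h * X * a / α ^ 2)
        / (1 - X ^ 2) / (1 - h ^ 2 * X ^ 2) +
      (1 - a * (X / h)) * (1 + α ^ 2 / a * (X / h)) * (1 - X / a) * (1 + X * a / α ^ 2) /
        ((1 - X ^ 2) * (1 - X ^ 2 / h ^ 2)) +
      (1 - a * X) * (1 + α ^ 2 / a * X) * (1 - h * a * X) * (1 + h * (α ^ 2 / a) * X) /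
        (α ^ 2 * (1 - X ^ 2) * (1 - h ^ 2 * X ^ 2)) +
      α ^ 2 * ((1 - X / a) * (1 + X * a / α ^ 2) * (1 - X / (h * a)) * (1 + X * a / (h * α ^ 2))) /
        ((1 - X ^ 2) * (1 - X ^ 2 / h ^ 2)) = 2 + α ^ 2 + (α ^ 2)⁻¹ := by
    have d3 : h ^ 2 - X ^ 2 ≠ 0 := by
      intro H
      apply d2
      rw [← sub_eq_zero.1 H, div_self (pow_ne_zero 2 hh), sub_self]
    rw [show 1 - X ^ 2 / h ^ 2 = (h ^ 2 - X ^ 2) / h ^ 2 by field_simp]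
    have d1' : 1 - (h * X) ^ 2 ≠ 0 := by rwa [mul_pow]
    have d1'' : 1 - X ^ 2 * h ^ 2 ≠ 0 := by rwa [mul_comm]
    field_simp
    ring
  have e5 : t⁻¹ * (1 + t) ^ 2 = t⁻¹ + 2 + t := by field_simp; ring
  rw [e1, e2]
  rw [e5] at e3
  linear_combination e3 - H * e4

end Algebra

/-! ### Explicit solutions for both specializations -/

section Existence

variable (κ lam s q : ℝ)

local notation "J" => paramsJ κ lam s q
local notation "R" => paramsR κ lam s q
local notation "h" => halfBase κ lam s q
local notation "w" => quarterBase κ lam s q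
local notation "α" => powκ κ lam s q

/-- The common entire factor of both eigenfunctions, as a function of `t` and `q ^ x`. -/
noncomputable def commonFactor (t Y : ℂ) : ℂ := entireSolution (J).a (J).b h t Y

/-- The coefficient functions for the parameters `(κ, lam, κ, lam; q, s)`. -/
noncomputable def gammaJ (r : ℕ) (z : ℂ) : ℂ :=
  qPochInf (-(h * (J).pow z)) h * entireCoeff (J).a (J).b h ((J).pow z) (r + 3)

/-- The coefficient functions for the parameters `(κ, lam, 0, 0; q, s / 2)`, where `β` are the
coefficients of the power series of `(h Y ^ 2; h ^ 2)_∞`. -/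
noncomputable def gammaR (β : ℕ → ℂ) (r : ℕ) (z : ℂ) : ℂ :=
  ∑ kl ∈ Finset.HasAntidiagonal.antidiagonal r,
    entireCoeff (J).a (J).b h ((J).pow z ^ 2) (kl.1 + 3) * β kl.2

variable {κ lam s q}
variable (hs : 0 < s) (hq0 : 0 < q) (hq1 : q < 1)

local notation "H" => commonFactor κ lam s q

include hq0

theorem paramsJ_b_eq : (J).b = -(α ^ 2 / (J).a) := by
  have α0 := powκ_ne_zero (κ := κ) (lam := lam) (s := s) hq0
  have μ0 := powLam_ne_zero (κ := κ) (lam := lam) (s := s) hq0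
  rw [paramsJ_a hq0, paramsJ_b hq0]
  field_simp

include hs hq1

theorem commonFactor_equation (t Y : ℂ) :
    t * ((1 - (J).a * Y) * (1 + α ^ 2 / (J).a * Y) * (1 - h * Y / (J).a) *
      (1 + h * Y * (J).a / α ^ 2)) * H t (h * Y) + H t (Y / h) = (1 + t) * (1 - Y ^ 2) * H t Y := by
  have hh := norm_halfBase_lt_one (κ := κ) (lam := lam) hs hq0 hq1
  have h0 := halfBase_ne_zero (κ := κ) (lam := lam) (s := s) hq0
  have α0 := powκ_ne_zero (κ := κ) (lam := lam) (s := s) hq0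
  have ha : (J).a ≠ 0 := Params.a_ne_zero (P := J) hq0
  have hb : (J).b ≠ 0 := Params.b_ne_zero (P := J) hq0
  have E := entireSolution_equation (J).a (J).b ha hb h0 hh t Y
  rw [show 1 - (J).b * Y = 1 + α ^ 2 / (J).a * Y by rw [paramsJ_b_eq hq0]; ring,
    show 1 - h * Y / (J).b = 1 + h * Y * (J).a / α ^ 2 by
      rw [paramsJ_b_eq hq0, div_neg, sub_neg_eq_add, div_div_eq_mul_div]] at E
  exact E

theorem paramsJ_normalizedEquation (X t : ℂ) (ht : t ≠ 0) (d0 : 1 - X ^ 2 ≠ 0)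
    (d1 : 1 - h ^ 2 * X ^ 2 ≠ 0) (d2 : 1 - X ^ 2 / h ^ 2 ≠ 0) (hI : (J).invFactor X ≠ 0) :
    (J).normalizedEquation X t (H t (h * (h * X))) (H t (X / h / h)) (H t X) = 0 := by
  have h0 := halfBase_ne_zero (κ := κ) (lam := lam) (s := s) hq0
  have α0 := powκ_ne_zero (κ := κ) (lam := lam) (s := s) hq0
  have ha : (J).a ≠ 0 := Params.a_ne_zero (P := J) hq0
  have E0 := commonFactor_equation (κ := κ) (lam := lam) hs hq0 hq1 t X
  have E1 := commonFactor_equation (κ := κ) (lam := lam) hs hq0 hq1 t (h * X)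
  have Em := commonFactor_equation (κ := κ) (lam := lam) hs hq0 hq1 t (X / h)
  rw [mul_div_cancel_left₀ _ h0] at E1
  rw [show H t (h * (X / h)) = H t X by rw [mul_div_cancel₀ _ h0]] at Em
  have S := second_order_of_first_order ha α0 h0 ht d0 d1 d2 E0 E1 Em
  have invF : ∀ Y, (J).invFactor Y = (1 - Y / (J).a) * (1 + Y * (J).a / α ^ 2) *
      (1 - Y / (h * (J).a)) * (1 + Y * (J).a / (h * α ^ 2)) := by
    intro Y
    rw [Params.invFactor, paramsJ_c hq0, paramsJ_d hq0, paramsJ_b_eq hq0, mul_neg, div_neg, div_neg,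
      sub_neg_eq_add, sub_neg_eq_add, div_div_eq_mul_div, ← mul_div_assoc, div_div_eq_mul_div]
  have invF2 : (J).invFactor (h ^ 2 * X) = (1 - h ^ 2 * X / (J).a) *
      (1 + h ^ 2 * X * (J).a / α ^ 2) * (1 - h * X / (J).a) * (1 + h * X * (J).a / α ^ 2) := by
    rw [invF, show h ^ 2 * X / (h * (J).a) = h * X / (J).a by field_simp,
      show h ^ 2 * X * (J).a / (h * α ^ 2) = h * X * (J).a / α ^ 2 by field_simp]
  have fwd : (J).forwardCoeff X = (1 - (J).a * X) * (1 + α ^ 2 / (J).a * X) *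
      (1 - h * (J).a * X) * (1 + h * (α ^ 2 / (J).a) * X) /
        (α ^ 2 * (1 - X ^ 2) * (1 - h ^ 2 * X ^ 2)) := by
    rw [Params.forwardCoeff, paramsJ_c hq0, paramsJ_d hq0, paramsJ_b_eq hq0, paramsJ_base hq0,
      paramsJ_dual_a hq0]
    ring
  have bwd : (J).backwardCoeff X = α ^ 2 * (J).invFactor X / ((1 - X ^ 2) * (1 - X ^ 2 / h ^ 2)) := by
    rw [Params.backwardCoeff, paramsJ_base hq0, paramsJ_dual_a hq0]
  have g1 : α ^ 2 * (J).forwardCoeff X = (1 - (J).a * X) * (1 + α ^ 2 / (J).a * X) *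
      (1 - h * (J).a * X) * (1 + h * (α ^ 2 / (J).a) * X) / ((1 - X ^ 2) * (1 - h ^ 2 * X ^ 2)) := by
    rw [fwd, mul_assoc (α ^ 2), ← div_div, ← mul_div_assoc, mul_div_cancel₀ _ (pow_ne_zero 2 α0)]
  have g2 : (J).backwardCoeff X * ((α ^ 2)⁻¹ * t⁻¹ / (J).invFactor X) =
      t⁻¹ / ((1 - X ^ 2) * (1 - X ^ 2 / h ^ 2)) := by
    rw [bwd]
    generalize (1 - X ^ 2) * (1 - X ^ 2 / h ^ 2) = D
    field_simp
  rw [← invF, ← invF2, ← g2, ← fwd, ← bwd, mul_assoc t, mul_comm _ ((J).invFactor _),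
    ← mul_assoc t, mul_div_assoc, ← g1] at S
  rw [Params.normalizedEquation, paramsJ_dual_a hq0, paramsJ_base hq0]
  linear_combination S

/-- `B` stands for `(h X ^ 2; h ^ 2)_∞`; the factors attached to it are its changes under `X ↦ h X`
and `X ↦ X / h`. They cancel the factors of `invFactor` due to `c` and `d`, and the equation becomes
the three-term relation at `t = τ ^ 2`. -/
theorem paramsR_normalizedEquation (X τ B : ℂ) (hτ : τ ≠ 0) (d0 : 1 - X ^ 2 ≠ 0)
    (d1 : 1 - h * X ^ 2 ≠ 0) (d2 : 1 - X ^ 2 / h ≠ 0) (hI : (R).invFactor X ≠ 0) :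
    (R).normalizedEquation X τ (H (τ ^ 2) (h * X) * (B / (1 - h * X ^ 2)))
      (H (τ ^ 2) (X / h) * ((1 - X ^ 2 / h) * B)) (H (τ ^ 2) X * B) = 0 := by
  have h0 := halfBase_ne_zero (κ := κ) (lam := lam) (s := s) hq0
  have α0 := powκ_ne_zero (κ := κ) (lam := lam) (s := s) hq0
  have w0 := quarterBase_ne_zero (κ := κ) (lam := lam) (s := s) hq0
  have hw := quarterBase_sq (κ := κ) (lam := lam) (s := s) hq0
  have ha : (J).a ≠ 0 := Params.a_ne_zero (P := J) hq0
  have E0 := commonFactor_equation (κ := κ) (lam := lam) hs hq0 hq1 (τ ^ 2) X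
  have invF : ∀ Y, (R).invFactor Y = (1 - Y / (J).a) * (1 + Y * (J).a / α ^ 2) *
      (1 - Y ^ 2 / h) := by
    intro Y
    rw [Params.invFactor, paramsR_c, paramsR_d, paramsR_a, paramsR_b, paramsJ_b_eq hq0, div_neg,
      div_neg, sub_neg_eq_add, sub_neg_eq_add, div_div_eq_mul_div, mul_assoc, ← hw, ← div_pow]
    ring
  have invF2 : (R).invFactor (h * X) = (1 - h * X / (J).a) *
      (1 + h * X * (J).a / α ^ 2) * (1 - h * X ^ 2) := by
    rw [invF, show (h * X) ^ 2 / h = h * X ^ 2 by field_simp]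
  have fwd : (R).forwardCoeff X = (1 - (J).a * X) * (1 + α ^ 2 / (J).a * X) /
      (α * (1 - X ^ 2)) := by
    rw [Params.forwardCoeff, paramsR_c, paramsR_d, paramsR_a, paramsR_b, paramsR_base,
      paramsR_dual_a, paramsJ_b_eq hq0, mul_assoc (_ * _) (1 - w * X),
      show (1 - w * X) * (1 - -w * X) = 1 - h * X ^ 2 by rw [← hw]; ring,
      mul_div_mul_right _ _ d1, neg_mul, sub_neg_eq_add]
  have bwd : (R).backwardCoeff X = α * ((1 - X / (J).a) * (1 + X * (J).a / α ^ 2)) /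
      (1 - X ^ 2) := by
    rw [Params.backwardCoeff, paramsR_base, paramsR_dual_a, invF, ← mul_assoc α,
      mul_div_mul_right _ _ d2]
  -- The two operator coefficients have constant sum, so the term in the unshifted value reduces to
  -- the eigenvalue part `τ + τ⁻¹`.
  have sum : (1 - (J).a * X) * (1 + α ^ 2 / (J).a * X) / (α * (1 - X ^ 2)) +
      α * ((1 - X / (J).a) * (1 + X * (J).a / α ^ 2)) / (1 - X ^ 2) = α + α⁻¹ := by
    field_simp
    ring
  have hHm : H (τ ^ 2) (X / h) = (1 + τ ^ 2) * (1 - X ^ 2) * H (τ ^ 2) X -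
      τ ^ 2 * ((1 - (J).a * X) * (1 + α ^ 2 / (J).a * X) * (1 - h * X / (J).a) *
      (1 + h * X * (J).a / α ^ 2)) * H (τ ^ 2) (h * X) := by linear_combination E0
  have g1 : (R).forwardCoeff X * (α * τ * (R).invFactor (h * X) *
      (H (τ ^ 2) (h * X) * (B / (1 - h * X ^ 2)))) = τ * ((1 - (J).a * X) *
      (1 + α ^ 2 / (J).a * X) * (1 - h * X / (J).a) * (1 + h * X * (J).a / α ^ 2)) /
      (1 - X ^ 2) * H (τ ^ 2) (h * X) * B := by
    rw [fwd, invF2]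
    generalize 1 - h * X ^ 2 = D at d1
    generalize 1 + h * X * (J).a / α ^ 2 = f1
    generalize 1 + α ^ 2 / (J).a * X = f2
    generalize 1 - h * X / (J).a = f3
    field_simp
  have g2 : (R).backwardCoeff X * (α⁻¹ * τ⁻¹ / (R).invFactor X *
      (H (τ ^ 2) (X / h) * ((1 - X ^ 2 / h) * B))) =
      τ⁻¹ / (1 - X ^ 2) * H (τ ^ 2) (X / h) * B := by
    rw [Params.backwardCoeff, paramsR_base, paramsR_dual_a]
    generalize (R).invFactor X = I at hI
    generalize 1 - X ^ 2 / h = D at d2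
    field_simp
  have g3 : τ * ((1 - (J).a * X) * (1 + α ^ 2 / (J).a * X) * (1 - h * X / (J).a) *
      (1 + h * X * (J).a / α ^ 2)) / (1 - X ^ 2) * H (τ ^ 2) (h * X) * B +
      τ⁻¹ / (1 - X ^ 2) * H (τ ^ 2) (X / h) * B = (τ + τ⁻¹) * H (τ ^ 2) X * B := by
    rw [hHm]
    generalize (1 - (J).a * X) * (1 + α ^ 2 / (J).a * X) * (1 - h * X / (J).a) *
      (1 + h * X * (J).a / α ^ 2) = Q
    field_simp
    ring
  rw [← fwd, ← bwd] at sum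
  rw [Params.normalizedEquation, paramsR_dual_a, paramsR_base]
  linear_combination g1 + g2 + g3 - H (τ ^ 2) X * B * sum

omit hs hq0 hq1 in
theorem gammaJ_series (x z : ℂ) : (J).series (gammaJ κ lam s q) x z =
    qPochInf (-(h * (J).pow z)) h * H ((J).pow z) ((J).pow x) := by
  rw [Params.series, commonFactor, entireSolution, ← tsum_mul_left]
  refine tsum_congr fun r => ?_
  rw [gammaJ, Params.pow_nat_mul, mul_assoc]

theorem gammaR_series {β : ℕ → ℂ} (hβ : ∀ Y : ℂ, (Summable fun n => ‖β n * Y ^ n‖) ∧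
      ∑' n, β n * Y ^ n = qPochInf (h * Y ^ 2) (h ^ 2)) (x z : ℂ) :
    (R).series (gammaR κ lam s q β) x z =
      H ((J).pow z ^ 2) ((J).pow x) * qPochInf (h * (J).pow x ^ 2) (h ^ 2) := by
  have hh := norm_halfBase_lt_one (κ := κ) (lam := lam) hs hq0 hq1
  obtain ⟨h1, h2⟩ := hβ ((J).pow x)
  rw [Params.series, commonFactor, entireSolution, ← h2,
    tsum_mul_tsum_eq_tsum_sum_antidiagonal_of_summable_norm
      (summable_entireCoeff_shift _ _ hh _ _) h1]
  refine tsum_congr fun r => ?_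
  rw [gammaR, Params.pow_nat_mul, Finset.sum_mul]
  refine Finset.sum_congr rfl fun kl hkl => ?_
  rw [← Finset.HasAntidiagonal.mem_antidiagonal.1 hkl, pow_add, paramsR_pow]
  ring

theorem isAsymptoticallyFree_gammaJ : (J).IsAsymptoticallyFree (gammaJ κ lam s q) := by
  have hh := norm_halfBase_lt_one (κ := κ) (lam := lam) hs hq0 hq1
  have h0 := halfBase_ne_zero (κ := κ) (lam := lam) (s := s) hq0
  have dpow : Differentiable ℂ (J).pow := Params.differentiable_pow (P := J) hq0
  have dq : Differentiable ℂ fun z => qPochInf (-(h * (J).pow z)) h :=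
    (differentiable_qPochInf hh).comp (dpow.const_mul h).neg
  refine ⟨fun r => ?_, fun z => ?_, fun K hK => ?_, fun x z k1 k2 k3 hx _ hm hz => ?_⟩
  · exact dq.mul ((differentiable_entireCoeff _ _ hh (r + 3)).comp dpow)
  -- The factor `(-h q^z; h)_∞` in `gammaJ` completes `(h q^z; h)_∞` to the prescribed `(h ^ 2
  -- q^(2z); h ^ 2)_∞`.
  · rw [gammaJ, entireCoeff_three _ _ h0, mul_comm, qPochInf_mul_neg hh, paramsJ_base hq0,
      Params.pow_add' (P := J) hq0, Params.pow_two_mul (P := J) hq0, paramsJ_base hq0, mul_pow]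
  · obtain ⟨T, hT⟩ := hK.exists_bound_of_continuousOn
      (dpow.continuous.comp continuous_snd).continuousOn
    obtain ⟨ρ, hρ⟩ := hK.exists_bound_of_continuousOn
      (dpow.continuous.comp continuous_fst).continuousOn
    obtain ⟨Q, hQ⟩ := hK.exists_bound_of_continuousOn (dq.continuous.comp continuous_snd).continuousOn
    obtain ⟨M, hM, hsum⟩ := norm_entireCoeff_shift_le (J).a (J).b hh T
    refine ⟨fun r => Q * (M r * (|ρ| + 1) ^ r), (hsum _ (by positivity)).mul_left Q,
      fun r p hp => ?_⟩
    have b1 := hQ p hp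
    have b2 := hM r _ (hT p hp)
    have b3 : ‖(J).pow p.1‖ ^ r ≤ (|ρ| + 1) ^ r :=
      pow_le_pow_left₀ (norm_nonneg _) ((hρ p hp).trans (by linarith [le_abs_self ρ])) r
    rw [gammaJ, Params.pow_nat_mul, mul_assoc, norm_mul, norm_mul, norm_pow]
    exact mul_le_mul b1 (mul_le_mul b2 b3 (by positivity) ((norm_nonneg _).trans b2)) (by positivity)
      ((norm_nonneg _).trans b1)
  · have hX := Params.pow_ne_zero' (P := J) hq0 x
    have ht := Params.pow_ne_zero' (P := J) hq0 z
    have hI : (J).invFactor ((J).pow x) ≠ 0 := by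
      intro e
      rw [Params.St_sub (P := J) hq0 hq1 hs, e, zero_mul] at hm
      exact hm rfl
    rw [Params.pow_two_mul (P := J) hq0] at k1
    rw [Params.pow_add' (P := J) hq0, Params.pow_two_mul (P := J) hq0, paramsJ_base hq0] at k2
    rw [Params.pow_sub' (P := J) hq0, Params.pow_two_mul (P := J) hq0, paramsJ_base hq0] at k3
    have d2 : 1 - (J).pow x ^ 2 / h ^ 2 ≠ 0 := by
      intro e
      rw [sub_eq_zero, eq_div_iff (pow_ne_zero 2 h0), one_mul] at e
      rw [e, div_self (pow_ne_zero 2 hX)] at k3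
      exact k3 rfl
    have N := paramsJ_normalizedEquation (κ := κ) (lam := lam) hs hq0 hq1 ((J).pow x) ((J).pow z) ht
      (sub_ne_zero.2 k1.symm) (sub_ne_zero.2 k2.symm) d2 hI
    simp only [Params.ansatz]
    rw [Params.equation_eq_normalizedEquation (P := J) hq0 hq1 hs
      (fun y => (J).series (gammaJ κ lam s q) y z) x z hx hm hz]
    simp only [gammaJ_series]
    rw [Params.pow_add' (P := J) hq0, Params.pow_sub' (P := J) hq0, paramsJ_base hq0,
      show (J).pow x * h ^ 2 = h * (h * (J).pow x) by ring,
      show (J).pow x / h ^ 2 = (J).pow x / h / h by rw [div_div, sq]]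
    -- The factor `(-h q^z; h)_∞` does not depend on `x`, so it passes through the linear equation.
    have lin : ∀ C u v y : ℂ, (J).normalizedEquation ((J).pow x) ((J).pow z) (C * u) (C * v) (C * y) =
        C * (J).normalizedEquation ((J).pow x) ((J).pow z) u v y := by
      intro C u v y
      simp only [Params.normalizedEquation]
      ring
    rw [lin, N, mul_zero, mul_zero]

theorem isAsymptoticallyFree_gammaR {β : ℕ → ℂ} (β0 : β 0 = 1)
    (hβ : ∀ Y : ℂ, (Summable fun n => ‖β n * Y ^ n‖) ∧
      ∑' n, β n * Y ^ n = qPochInf (h * Y ^ 2) (h ^ 2)) :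
    (R).IsAsymptoticallyFree (gammaR κ lam s q β) := by
  have hh := norm_halfBase_lt_one (κ := κ) (lam := lam) hs hq0 hq1
  have h0 := halfBase_ne_zero (κ := κ) (lam := lam) (s := s) hq0
  have dpow : Differentiable ℂ (J).pow := Params.differentiable_pow (P := J) hq0
  have hs2 : 0 < (R).s := half_pos hs
  refine ⟨fun r => ?_, fun z => ?_, fun K hK => ?_, fun x z k1 k2 k3 hx _ hm hz => ?_⟩
  · unfold gammaR
    exact Differentiable.fun_sum fun kl _ =>
      ((differentiable_entireCoeff _ _ hh (kl.1 + 3)).comp (dpow.pow 2)).mul_const _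
  · rw [gammaR, Finset.HasAntidiagonal.antidiagonal_zero, Finset.sum_singleton, β0, mul_one, zero_add,
      entireCoeff_three _ _ h0, Params.pow_add' (P := R) hq0, Params.pow_two_mul (P := R) hq0,
      paramsR_base]
    rfl
  · obtain ⟨T, hT⟩ := hK.exists_bound_of_continuousOn
      ((dpow.pow 2).continuous.comp continuous_snd).continuousOn
    obtain ⟨ρ, hρ⟩ := hK.exists_bound_of_continuousOn
      (dpow.continuous.comp continuous_fst).continuousOn
    obtain ⟨M, hM, hsum⟩ := norm_entireCoeff_shift_le (J).a (J).b hh T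
    have hρ0 : 0 < |ρ| + 1 := by positivity
    have s1 : Summable fun n => ‖M n * (|ρ| + 1) ^ n‖ := (hsum _ hρ0).norm
    have s2 : Summable fun n => ‖‖β n‖ * (|ρ| + 1) ^ n‖ := by
      refine (hβ ((|ρ| + 1 : ℝ) : ℂ)).1.congr fun n => ?_
      rw [norm_mul, norm_pow, norm_mul, norm_norm, Complex.norm_real, norm_pow]
    -- The majorant is the Cauchy product of the majorants of the two factors, at the positive
    -- radius `|ρ| + 1`.
    refine ⟨_, summable_norm_sum_mul_antidiagonal_of_summable_norm s1 s2, fun r p hp => ?_⟩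
    refine le_trans ?_ (le_abs_self _)
    rw [gammaR, Params.pow_nat_mul, Finset.sum_mul]
    refine norm_sum_le_of_le _ fun kl hkl => ?_
    have b2 := hM kl.1 _ (hT p hp)
    have b3 : ∀ i : ℕ, ‖(J).pow p.1‖ ^ i ≤ (|ρ| + 1) ^ i := fun i =>
      pow_le_pow_left₀ (norm_nonneg _) ((hρ p hp).trans (by linarith [le_abs_self ρ])) i
    rw [← Finset.HasAntidiagonal.mem_antidiagonal.1 hkl, pow_add, paramsR_pow,
      mul_mul_mul_comm, norm_mul, norm_mul, norm_mul, norm_pow, norm_pow]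
    refine mul_le_mul (mul_le_mul b2 (b3 _) (by positivity) ((norm_nonneg _).trans b2))
      (mul_le_mul_of_nonneg_left (b3 _) (norm_nonneg _)) (by positivity)
      (mul_nonneg ((norm_nonneg _).trans b2) (by positivity))
  · have hX := Params.pow_ne_zero' (P := J) hq0 x
    have ht := Params.pow_ne_zero' (P := J) hq0 z
    have hI : (R).invFactor ((J).pow x) ≠ 0 := by
      intro e
      rw [Params.St_sub (P := R) hq0 hq1 hs2, paramsR_pow, e, zero_mul] at hm
      exact hm rfl
    rw [Params.pow_two_mul (P := R) hq0, paramsR_pow] at k1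
    rw [Params.pow_add' (P := R) hq0, Params.pow_two_mul (P := R) hq0, paramsR_base,
      paramsR_pow] at k2
    rw [Params.pow_sub' (P := R) hq0, Params.pow_two_mul (P := R) hq0, paramsR_base,
      paramsR_pow] at k3
    have d1 : 1 - h * (J).pow x ^ 2 ≠ 0 := sub_ne_zero.2 k2.symm
    have d2 : 1 - (J).pow x ^ 2 / h ≠ 0 := by
      intro e
      rw [sub_eq_zero, eq_div_iff h0, one_mul] at e
      rw [e, div_self (pow_ne_zero 2 hX)] at k3
      exact k3 rfl
    have hp := norm_sq_lt_one hh
    have N := paramsR_normalizedEquation (κ := κ) (lam := lam) hs hq0 hq1 ((J).pow x) ((J).pow z)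
      (qPochInf (h * (J).pow x ^ 2) (h ^ 2)) ht (sub_ne_zero.2 k1.symm) d1 d2 hI
    simp only [Params.ansatz]
    rw [Params.equation_eq_normalizedEquation (P := R) hq0 hq1 hs2
      (fun y => (R).series (gammaR κ lam s q β) y z) x z hx hm hz]
    simp only [gammaR_series hs hq0 hq1 hβ]
    have eadd : (J).pow (x + (R).s) = h * (J).pow x := by
      rw [Params.pow_add' (P := J) hq0, mul_comm]
      exact congrArg (· * (J).pow x) paramsR_base
    have esub : (J).pow (x - (R).s) = (J).pow x / h := by
      rw [Params.pow_sub' (P := J) hq0]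
      exact congrArg ((J).pow x / ·) paramsR_base
    have B1 : qPochInf (h * (h * (J).pow x) ^ 2) (h ^ 2) =
        qPochInf (h * (J).pow x ^ 2) (h ^ 2) / (1 - h * (J).pow x ^ 2) := by
      rw [qPochInf_step hp (h * (J).pow x ^ 2), mul_div_cancel_left₀ _ d1]
      congr 1
      ring
    have B2 : qPochInf (h * ((J).pow x / h) ^ 2) (h ^ 2) =
        (1 - (J).pow x ^ 2 / h) * qPochInf (h * (J).pow x ^ 2) (h ^ 2) := by
      rw [qPochInf_step hp, show h * ((J).pow x / h) ^ 2 = (J).pow x ^ 2 / h by field_simp,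
        show (J).pow x ^ 2 / h * h ^ 2 = h * (J).pow x ^ 2 by field_simp]
    rw [eadd, esub, B1, B2, paramsR_pow, paramsR_pow, N, mul_zero]

end Existence

end AskeyWilson

/-! ### The theorem -/

theorem mainTheorem1 (κ lam s q : ℝ) (hs : 0 < s) (hq0 : 0 < q) (hq1 : q < 1) :
    (∃! Γ : ℕ → ℂ → ℂ, (AskeyWilson.paramsJ κ lam s q).IsAsymptoticallyFree Γ) ∧
    (∃! Γ : ℕ → ℂ → ℂ, (AskeyWilson.paramsR κ lam s q).IsAsymptoticallyFree Γ) ∧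
    ∀ x z : ℂ,
      (AskeyWilson.paramsJ κ lam s q).St x ≠ 0 →
      (AskeyWilson.paramsJ κ lam s q).dual.St z ≠ 0 →
      (AskeyWilson.paramsR κ lam s q).St x ≠ 0 →
      (AskeyWilson.paramsR κ lam s q).dual.St (z / 2) ≠ 0 →
        (AskeyWilson.paramsJ κ lam s q).Phi x z =
          (AskeyWilson.paramsR κ lam s q).Phi x (z / 2) := by
  have hh := AskeyWilson.norm_halfBase_lt_one (κ := κ) (lam := lam) hs hq0 hq1
  have hs2 : 0 < (AskeyWilson.paramsR κ lam s q).s := half_pos hs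
  obtain ⟨β, β0, hβ⟩ := AskeyWilson.exists_coeff_qPochInf_sq hh
  have fJ := AskeyWilson.isAsymptoticallyFree_gammaJ (κ := κ) (lam := lam) hs hq0 hq1
  have fR := AskeyWilson.isAsymptoticallyFree_gammaR (κ := κ) (lam := lam) hs hq0 hq1 β0 hβ
  refine ⟨⟨_, fJ, fun Γ hΓ => hΓ.unique hq0 hq1 hs fJ⟩,
    ⟨_, fR, fun Γ hΓ => hΓ.unique hq0 hq1 hs2 fR⟩, fun x z hJx hJz hRx hRz => ?_⟩
  have ht : (AskeyWilson.paramsJ κ lam s q).pow (z / 2) ^ 2 =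
      (AskeyWilson.paramsJ κ lam s q).pow z := by
    rw [← AskeyWilson.Params.pow_two_mul (P := AskeyWilson.paramsJ κ lam s q) hq0, mul_div_cancel₀]
    exact two_ne_zero
  rw [AskeyWilson.Params.Phi, AskeyWilson.Params.Phi, fJ.Gam_eq hq0 hq1 hs, fR.Gam_eq hq0 hq1 hs2,
    AskeyWilson.Params.ansatz, AskeyWilson.Params.ansatz,
    AskeyWilson.gammaJ_series, AskeyWilson.gammaR_series hs hq0 hq1 hβ,
    AskeyWilson.paramsR_W hs.ne', AskeyWilson.paramsJ_dual_St hs hq0 hq1,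
    AskeyWilson.paramsR_St hs hq0 hq1, ht]
  rw [AskeyWilson.paramsR_St hs hq0 hq1] at hRx
  rw [AskeyWilson.paramsJ_dual_St hs hq0 hq1] at hJz
  -- The extra product in each singular term equals the factor by which the corresponding series
  -- differs from `H`; being nonzero here, it cancels on either side.
  have n1 := right_ne_zero_of_mul hRx
  have n2 := right_ne_zero_of_mul hJz
  field_simp
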